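/- Let $n\geqslant1$ and let $\Omega$ be a domain (nonempty, open, connected) in the space $\mathbb R\times\mathbb R^n\times\mathbb R_{>0}$ of the variables $(t,x,\rho)$. For a smooth function $S\colon\Omega\to\mathbb C$ consider the nonlinear Schrödinger equation $$\mathcal L_S\colon\quad i\psi_t+\sum_{a=1}^n\psi_{aa}+S(t,x,|\psi|)\,\psi=0,\qquad \psi=\psi(t,x)\in\mathbb C,$$ on the set $M_\Omega=\{(t,x,\psi)\in\mathbb R\times\mathbb R^n\times\mathbb C : (t,x,|\psi|)\in\Omega\}$. Let $\mathfrak g_S$ denote its maximal Lie invariance algebra, that is, the real vector space of all vector fields $$Q=\tau\partial_t+\sum_{a=1}^n\xi^a\partial_{x_a}+\eta\,\partial_\psi+\eta^*\partial_{\psi^*}$$ on $M_\Omega$, with smooth real-valued $\tau,\xi^a$ and smooth complex-valued $\eta$ depending on $(t,x,\psi,\psi^*)$, that satisfy the infinitesimal invariance criterion $$Q_{(2)}\Big(i\psi_t+\sum_{a=1}^n\psi_{aa}+S(t,x,|\psi|)\psi\Big)=0$$ at all points of the second-order jet space over $M_\Omega$ at which $i\psi_t+\sum_a\psi_{aa}+S(t,x,|\psi|)\psi=0$,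 where $Q_{(2)}$ is the second prolongation of $Q$. If $S_\rho\ne0$, in the sense that $S_\rho$ does not vanish identically on any nonempty open subset of $\Omega$ (in particular, if $S_\rho$ vanishes nowhere), then $\mathfrak g_S$ is finite-dimensional and $$\dim_{\mathbb R}\mathfrak g_S\leqslant\frac{n(n+3)}2+4.$$ This upper bound is the least possible: the function $S=\rho^{4/n}$ satisfies $S_\rho\ne0$, and $\dim_{\mathbb R}\mathfrak g_S=\frac{n(n+3)}2+4$ for it. -/

import Mathlib

open scoped ContDiff

noncomputable section

namespace NLS

/-- The space of the variables `(t, x, ψ)`: a point is `(z, ψ)` with `z 0 = t` and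
`z a.succ = x_a`. It is regarded as a real space, so that a real-smooth function on it is a smooth
function of `(t, x, ψ, ψ*)`. -/
abbrev Base (n : ℕ) : Type := (Fin (n + 1) → ℝ) × ℂ

/-- First-order jets `((z, ψ), (ψ_μ))`. -/
abbrev Jet1 (n : ℕ) : Type := Base n × (Fin (n + 1) → ℂ)

/-- Second-order jets `(((z, ψ), (ψ_μ)), (ψ_{μν}))`; the array `ψ_{μν}` of a genuine jet is
symmetric, which is required where jets are quantified over. -/
abbrev Jet2 (n : ℕ) : Type := Jet1 n × (Fin (n + 1) → Fin (n + 1) → ℂ)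

/-- The points `(z, ψ)` with `(z, |ψ|) ∈ Ω`. -/
def dom {n : ℕ} (Ω : Set ((Fin (n + 1) → ℝ) × ℝ)) : Set (Base n) :=
  {p | (p.1, ‖p.2‖) ∈ Ω}

/-- The derivative `S_ρ` of `S = S(z, ρ)`. -/
def derivRho {n : ℕ} (S : (Fin (n + 1) → ℝ) × ℝ → ℂ) (q : (Fin (n + 1) → ℝ) × ℝ) : ℂ :=
  deriv (fun r : ℝ => S (q.1, r)) q.2

/-- `Ω` is a domain (nonempty, open, connected) in the space of `(t, x, ρ)` with `ρ > 0`. -/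
structure IsDomainRho {n : ℕ} (Ω : Set ((Fin (n + 1) → ℝ) × ℝ)) : Prop where
  isOpen : IsOpen Ω
  isConnected : IsConnected Ω
  rho_pos : ∀ q ∈ Ω, 0 < q.2

/-- `S` is a smooth complex-valued function on `Ω` with `S_ρ ≠ 0`, in the sense that `S_ρ` does not
vanish identically on any nonempty open subset of `Ω`. -/
structure IsClassS {n : ℕ} (Ω : Set ((Fin (n + 1) → ℝ) × ℝ))
    (S : (Fin (n + 1) → ℝ) × ℝ → ℂ) : Prop where
  smooth : ContDiffOn ℝ ∞ S Ω
  derivRho_ne : ∀ U : Set ((Fin (n + 1) → ℝ) × ℝ), IsOpen U → U ⊆ Ω → U.Nonempty →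
    ∃ q ∈ U, derivRho S q ≠ 0

/-- Total derivative `D_μ f = f_μ + ψ_μ f_ψ + ψ*_μ f_{ψ*}` of a function of `(z, ψ, ψ*)`. -/
def totalDeriv1 {n : ℕ} {F : Type*} [NormedAddCommGroup F] [NormedSpace ℝ F]
    (μ : Fin (n + 1)) (f : Base n → F) (j : Jet1 n) : F :=
  fderiv ℝ f j.1 (Pi.single μ 1, j.2 μ)

/-- Total derivative `D_μ f` of a function on the first-order jet space. -/
def totalDeriv2 {n : ℕ} {F : Type*} [NormedAddCommGroup F] [NormedSpace ℝ F]
    (μ : Fin (n + 1)) (f : Jet1 n → F) (j : Jet2 n) : F :=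
  fderiv ℝ f j.1 ((Pi.single μ 1, j.1.2 μ), j.2 μ)

/-- First prolongation coefficient `η^μ = D_μ η - (D_μ ξ^ν) ψ_ν` of the vector field
`Q = ξ^ν ∂_ν + η ∂_ψ + η* ∂_{ψ*}` (with `ξ^0 = τ`), where `Q p = ((ξ^ν p)_ν, η p)`. -/
def prol1 {n : ℕ} (Q : Base n → Base n) (μ : Fin (n + 1)) (j : Jet1 n) : ℂ :=
  totalDeriv1 μ (fun p => (Q p).2) j
    - ∑ ν, totalDeriv1 μ (fun p => (Q p).1 ν) j • j.2 ν

/-- Second prolongation coefficient `η^{μν} = D_ν η^μ - (D_ν ξ^κ) ψ_{κμ}`. -/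
def prol2 {n : ℕ} (Q : Base n → Base n) (μ ν : Fin (n + 1)) (j : Jet2 n) : ℂ :=
  totalDeriv2 ν (prol1 Q μ) j
    - ∑ κ, totalDeriv1 ν (fun p => (Q p).1 κ) j.1 • j.2 κ μ

/-- The second prolongation `Q_(2)`, a vector field on the second-order jet space. -/
def prolong {n : ℕ} (Q : Base n → Base n) (j : Jet2 n) : Jet2 n :=
  ((Q j.1.1, fun μ => prol1 Q μ j.1), fun μ ν => prol2 Q μ ν j)

/-- The left-hand side `i ψ_t + ψ_{aa} + S(t, x, |ψ|) ψ` of the equation, as a function of jets. -/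
def eqn {n : ℕ} (S : (Fin (n + 1) → ℝ) × ℝ → ℂ) (j : Jet2 n) : ℂ :=
  Complex.I * j.1.2 0 + ∑ a : Fin n, j.2 a.succ a.succ + S (j.1.1.1, ‖j.1.1.2‖) * j.1.1.2

/-- The infinitesimal invariance criterion: `Q_(2)` applied to the left-hand side of the equation
vanishes at all second-order jets over `dom Ω` that satisfy the equation. -/
def InvCriterion {n : ℕ} (Ω : Set ((Fin (n + 1) → ℝ) × ℝ)) (S : (Fin (n + 1) → ℝ) × ℝ → ℂ)
    (Q : Base n → Base n) : Prop :=
  ∀ j : Jet2 n, j.1.1 ∈ dom Ω → (∀ μ ν, j.2 μ ν = j.2 ν μ) → eqn S j = 0 →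
    fderiv ℝ (eqn S) j (prolong Q j) = 0

lemma isOpen_dom {n : ℕ} {Ω : Set ((Fin (n + 1) → ℝ) × ℝ)} (h : IsOpen Ω) : IsOpen (dom Ω) :=
  h.preimage (by fun_prop : Continuous fun p : Base n => (p.1, ‖p.2‖))

section linearity

variable {n : ℕ} {M : Set (Base n)} {Q R : Base n → Base n}

lemma smooth_fst (hM : IsOpen M) (hQ : ContDiffOn ℝ ∞ Q M) (ν : Fin (n + 1)) {p : Base n}
    (hp : p ∈ M) : ContDiffAt ℝ ∞ (fun p => (Q p).1 ν) p :=
  (contDiffAt_pi.1 (contDiffAt_fst.comp p (hQ.contDiffAt (hM.mem_nhds hp)))) ν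

lemma smooth_snd (hM : IsOpen M) (hQ : ContDiffOn ℝ ∞ Q M) {p : Base n}
    (hp : p ∈ M) : ContDiffAt ℝ ∞ (fun p => (Q p).2) p :=
  contDiffAt_snd.comp p (hQ.contDiffAt (hM.mem_nhds hp))

lemma totalDeriv1_differentiableAt {F : Type*} [NormedAddCommGroup F] [NormedSpace ℝ F]
    {f : Base n → F} {j : Jet1 n} (hf : ContDiffAt ℝ ∞ f j.1) (μ : Fin (n + 1)) :
    DifferentiableAt ℝ (totalDeriv1 μ f) j := by
  have h1 : DifferentiableAt ℝ (fderiv ℝ f) j.1 :=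
    (hf.fderiv_right (m := 1) (by norm_cast)).differentiableAt (by norm_num)
  have h2 : DifferentiableAt ℝ (fun j : Jet1 n => fderiv ℝ f j.1) j :=
    h1.comp j differentiableAt_fst
  have h3 : DifferentiableAt ℝ
      (fun j : Jet1 n => ((Pi.single μ 1, j.2 μ) : Base n)) j := by fun_prop
  exact h2.clm_apply h3

lemma prol1_differentiableAt (hM : IsOpen M) (hQ : ContDiffOn ℝ ∞ Q M) {j : Jet1 n}
    (hj : j.1 ∈ M) (μ : Fin (n + 1)) : DifferentiableAt ℝ (prol1 Q μ) j := by
  unfold prol1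
  refine (totalDeriv1_differentiableAt (smooth_snd hM hQ hj) μ).sub ?_
  refine DifferentiableAt.fun_sum fun ν _ => ?_
  exact (totalDeriv1_differentiableAt (smooth_fst hM hQ ν hj) μ).smul (by fun_prop)

lemma totalDeriv1_lin {F : Type*} [NormedAddCommGroup F] [NormedSpace ℝ F]
    {f g : Base n → F} {j : Jet1 n} (hf : ContDiffAt ℝ ∞ f j.1) (hg : ContDiffAt ℝ ∞ g j.1)
    (c : ℝ) (μ : Fin (n + 1)) :
    totalDeriv1 μ (fun p => c • f p + g p) j = c • totalDeriv1 μ f j + totalDeriv1 μ g j := by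
  have hf' := hf.differentiableAt (by simp)
  have hg' := hg.differentiableAt (by simp)
  unfold totalDeriv1
  rw [fderiv_fun_add (hf'.fun_const_smul c) hg', fderiv_fun_const_smul hf']
  simp

lemma prol1_lin (hM : IsOpen M) (hQ : ContDiffOn ℝ ∞ Q M) (hR : ContDiffOn ℝ ∞ R M) (c : ℝ)
    {j : Jet1 n} (hj : j.1 ∈ M) (μ : Fin (n + 1)) :
    prol1 (fun p => c • Q p + R p) μ j = c • prol1 Q μ j + prol1 R μ j := by
  have h1 := totalDeriv1_lin (smooth_snd hM hQ hj) (smooth_snd hM hR hj) c μ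
  have h2 := fun ν => totalDeriv1_lin (smooth_fst hM hQ ν hj) (smooth_fst hM hR ν hj) c μ
  simp only [prol1, Prod.snd_add, Prod.smul_snd, Prod.fst_add, Prod.smul_fst, Pi.add_apply,
    Pi.smul_apply, h1, h2, add_smul, Finset.sum_add_distrib, smul_sub, Finset.smul_sum, smul_assoc]
  abel

lemma prol2_lin (hM : IsOpen M) (hQ : ContDiffOn ℝ ∞ Q M) (hR : ContDiffOn ℝ ∞ R M) (c : ℝ)
    {j : Jet2 n} (hj : j.1.1 ∈ M) (μ ν : Fin (n + 1)) :
    prol2 (fun p => c • Q p + R p) μ ν j = c • prol2 Q μ ν j + prol2 R μ ν j := by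
  have h2 := fun κ => totalDeriv1_lin (smooth_fst hM hQ κ hj) (smooth_fst hM hR κ hj) c ν
  have hev : prol1 (fun p => c • Q p + R p) μ =ᶠ[nhds j.1]
      fun i => c • prol1 Q μ i + prol1 R μ i := by
    filter_upwards [(hM.preimage continuous_fst).mem_nhds hj] with i hi
    exact prol1_lin hM hQ hR c hi μ
  have hQ' := prol1_differentiableAt hM hQ hj μ
  have hR' := prol1_differentiableAt hM hR hj μ
  have h1 : totalDeriv2 ν (prol1 (fun p => c • Q p + R p) μ) j
      = c • totalDeriv2 ν (prol1 Q μ) j + totalDeriv2 ν (prol1 R μ) j := by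
    unfold totalDeriv2
    rw [hev.fderiv_eq, fderiv_fun_add (hQ'.fun_const_smul c) hR', fderiv_fun_const_smul hQ']
    simp
  simp only [prol2, h1, Prod.fst_add, Prod.smul_fst, Pi.add_apply,
    Pi.smul_apply, h2, add_smul, Finset.sum_add_distrib, smul_sub, Finset.smul_sum, smul_assoc]
  abel

lemma prolong_lin (hM : IsOpen M) (hQ : ContDiffOn ℝ ∞ Q M) (hR : ContDiffOn ℝ ∞ R M) (c : ℝ)
    {j : Jet2 n} (hj : j.1.1 ∈ M) :
    prolong (fun p => c • Q p + R p) j = c • prolong Q j + prolong R j := by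
  refine Prod.ext (Prod.ext rfl ?_) ?_
  · funext μ
    exact prol1_lin hM hQ hR c hj μ
  · funext μ ν
    exact prol2_lin hM hQ hR c hj μ ν

end linearity

lemma prolong_zero {n : ℕ} (j : Jet2 n) : prolong (0 : Base n → Base n) j = 0 := by
  have h : ∀ μ, prol1 (0 : Base n → Base n) μ = fun _ => 0 := by
    intro μ
    funext i
    simp [prol1, totalDeriv1]
  refine Prod.ext (Prod.ext rfl ?_) ?_
  · funext μ
    simp [prolong, h]
  · funext μ ν
    simp [prolong, prol2, h, totalDeriv1, totalDeriv2]

lemma lin_mem {n : ℕ} {Ω : Set ((Fin (n + 1) → ℝ) × ℝ)} (hΩ : IsOpen Ω)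
    {S : (Fin (n + 1) → ℝ) × ℝ → ℂ} {Q R : Base n → Base n}
    (hQ : ContDiffOn ℝ ∞ Q (dom Ω)) (hR : ContDiffOn ℝ ∞ R (dom Ω))
    (hQi : InvCriterion Ω S Q) (hRi : InvCriterion Ω S R) (c : ℝ) :
    InvCriterion Ω S (fun p => c • Q p + R p) := by
  intro j hj hs he
  rw [prolong_lin (isOpen_dom hΩ) hQ hR c hj, map_add, map_smul, hQi j hj hs he, hRi j hj hs he]
  simp

/-- The maximal Lie invariance algebra `𝔤_S` over `Ω`, as a real vector space: all smooth vector
fields on `dom Ω` that satisfy the infinitesimal invariance criterion. A vector field on `dom Ω` is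
represented by its extension by zero, so that distinct elements differ on `dom Ω`. -/
def lieInvAlg {n : ℕ} {Ω : Set ((Fin (n + 1) → ℝ) × ℝ)} (hΩ : IsDomainRho Ω)
    (S : (Fin (n + 1) → ℝ) × ℝ → ℂ) : Submodule ℝ (Base n → Base n) where
  carrier := {Q | ContDiffOn ℝ ∞ Q (dom Ω) ∧ (∀ p, p ∉ dom Ω → Q p = 0) ∧ InvCriterion Ω S Q}
  zero_mem' := by
    refine ⟨contDiffOn_const, fun _ _ => rfl, fun j _ _ _ => ?_⟩
    rw [prolong_zero, map_zero]
  add_mem' := by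
    rintro Q R ⟨hQ, hQ0, hQi⟩ ⟨hR, hR0, hRi⟩
    refine ⟨hQ.add hR, fun p hp => by simp [hQ0 p hp, hR0 p hp], ?_⟩
    simpa [Pi.add_def] using lin_mem hΩ.isOpen hQ hR hQi hRi 1
  smul_mem' := by
    rintro c Q ⟨hQ, hQ0, hQi⟩
    refine ⟨contDiffOn_const.smul hQ, fun p hp => by simp [hQ0 p hp], ?_⟩
    have hz : InvCriterion Ω S (0 : Base n → Base n) := fun j _ _ _ => by
      rw [prolong_zero, map_zero]
    have he : c • Q = fun p => c • Q p + (0 : Base n → Base n) p := by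
      funext p
      simp
    rw [he]
    exact lin_mem hΩ.isOpen hQ contDiffOn_const hQi hz c

/-- `S = ρ^{4/n}`. -/
def powerS (n : ℕ) (q : (Fin (n + 1) → ℝ) × ℝ) : ℂ := ((q.2 ^ (4 / (n : ℝ)) : ℝ) : ℂ)

end NLS

end

/-! After elimination of ψ_t by the equation, the criterion is a polynomial identity in the
remaining jet variables. Evaluating it at well-chosen jets (`CritOn.detEqns`) shows that τ is
independent of x and ψ; that ξ is independent of ψ with ∂_aξ^b + ∂_bξ^a = δ_{ab} τ_t; that η = ζψ +
η⁰ with ζ and η⁰ locally independent of ψ; and that 2ζ_a = iξ^a_t. One equation involving S remains.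
Since S sees ψ only through |ψ|, comparing that equation at ψ, -ψ and iψ splits it into ρS_ρ η⁰ = 0
and the classifying equation iζ_t + Δζ + τ_t S + τS_t + ξ^a S_a + (Re ζ) ρS_ρ = 0
(`DetEqns.classVal_and_radial`). As S_ρ ≠ 0 on a dense set, η⁰ = 0 (`DetEqns.eta_eq`).

Upper bound: τ, τ_t, τ_tt, ζ, ξ, ξ_t and ∂_bξ^a satisfy a closed linear first-order system with
smooth coefficients. The second x-derivatives of ξ vanish as for Killing fields, and ξ_tt and τ_ttt
come from differentiating the classifying equation in x. On the connected set `dom Ω` a solution is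
determined by its values at one point (`eq_zero_of_linear_system`, `ReducedSystem.eq_zero`). Modulo
the Killing relations this leaves n(n+3)/2 + 5 numbers, one too many. The superfluous one is τ_t:
where τ, ξ and Re ζ vanish, differentiating the classifying equation in ψ leaves τ_t S_ρ = 0, so τ_t
= 0 at a point with S_ρ ≠ 0 (`ReducedSystem.tau_time_eq_zero`). Hence `jetMap`, which omits τ_t, is
injective.

Lower bound: for S = ρ^{4/n} one has ρS_ρ = (4/n)S, so Re ζ = -(n/4)τ_t solves the classifying
equation with τ any quadratic polynomial in t. Translations, rotations, Galilean boosts, the phase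
shift, the scaling and the conformal symmetry then form a family of exactly the required dimension
(`critMap_injective`). -/

open scoped ContDiff

noncomputable section

namespace NLS

/-! ### Calculus of derivatives in constant directions. -/

section DirectionalDerivative

variable {E F : Type*} [NormedAddCommGroup E] [NormedSpace ℝ E]
  [NormedAddCommGroup F] [NormedSpace ℝ F] {M : Set E}

/-- The derivative of `f` in the constant direction `v`. -/
def pd (v : E) (f : E → F) (p : E) : F := fderiv ℝ f p v

lemma differentiableAt_of_smooth (hM : IsOpen M) {f : E → F} (hf : ContDiffOn ℝ ∞ f M) {p : E}
    (hp : p ∈ M) : DifferentiableAt ℝ f p :=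
  (hf.contDiffAt (hM.mem_nhds hp)).differentiableAt (by simp)

lemma pd_smooth (hM : IsOpen M) {f : E → F} (hf : ContDiffOn ℝ ∞ f M) (v : E) :
    ContDiffOn ℝ ∞ (pd v f) M := by
  have h := hf.fderiv_of_isOpen (m := ∞) hM (by simp)
  exact h.clm_apply contDiffOn_const

lemma pd_congr (hM : IsOpen M) {f g : E → F} (h : ∀ p ∈ M, f p = g p) (v : E) {p : E}
    (hp : p ∈ M) : pd v f p = pd v g p := by
  have : f =ᶠ[nhds p] g := by
    filter_upwards [hM.mem_nhds hp] with q hq using h q hq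
  rw [pd, this.fderiv_eq, pd]

lemma pd_comm (hM : IsOpen M) {f : E → F} (hf : ContDiffOn ℝ ∞ f M) (v w : E) {p : E}
    (hp : p ∈ M) : pd v (pd w f) p = pd w (pd v f) p := by
  have hc := hf.contDiffAt (hM.mem_nhds hp)
  have hd : DifferentiableAt ℝ (fderiv ℝ f) p :=
    (hc.fderiv_right (m := 1) (by norm_cast)).differentiableAt (by norm_num)
  have hs : IsSymmSndFDerivAt ℝ f p := hc.isSymmSndFDerivAt (by simp; norm_cast)
  have key : ∀ a b : E, pd a (pd b f) p = fderiv ℝ (fderiv ℝ f) p a b := by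
    intro a b
    unfold pd
    rw [fderiv_clm_apply hd (differentiableAt_const b)]
    simp
  rw [key, key]
  exact hs v w

lemma pd_add_dir (f : E → F) (v w p : E) : pd (v + w) f p = pd v f p + pd w f p := by
  simp [pd]

lemma pd_smul_dir (f : E → F) (c : ℝ) (v p : E) : pd (c • v) f p = c • pd v f p := by
  simp [pd]

lemma pd_zero_dir (f : E → F) (p : E) : pd 0 f p = 0 := by
  simp [pd]

lemma pd_const (v : E) (c : F) (p : E) : pd v (fun _ => c) p = 0 := by
  simp [pd]

lemma pd_eq_zero_of_const (hM : IsOpen M) {f : E → F} {c : F} (h : ∀ p ∈ M, f p = c) (v : E)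
    {p : E} (hp : p ∈ M) : pd v f p = 0 := by
  rw [pd_congr hM h v hp, pd_const]

lemma pd_clm (L : E →L[ℝ] F) (v p : E) : pd v (fun q => L q) p = L v := by
  simp [pd]

lemma pd_add {f g : E → F} {p : E} (hf : DifferentiableAt ℝ f p) (hg : DifferentiableAt ℝ g p)
    (v : E) : pd v (fun q => f q + g q) p = pd v f p + pd v g p := by
  simp [pd, fderiv_fun_add hf hg]

lemma pd_sub {f g : E → F} {p : E} (hf : DifferentiableAt ℝ f p) (hg : DifferentiableAt ℝ g p)
    (v : E) : pd v (fun q => f q - g q) p = pd v f p - pd v g p := by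
  simp [pd, fderiv_fun_sub hf hg]

lemma pd_sum {ι : Type*} {s : Finset ι} {f : ι → E → F} {p : E}
    (hf : ∀ i ∈ s, DifferentiableAt ℝ (f i) p) (v : E) :
    pd v (fun q => ∑ i ∈ s, f i q) p = ∑ i ∈ s, pd v (f i) p := by
  simp [pd, fderiv_fun_sum hf]

lemma pd_mul {A : Type*} [NormedCommRing A] [NormedAlgebra ℝ A] {f g : E → A} {p : E}
    (hf : DifferentiableAt ℝ f p) (hg : DifferentiableAt ℝ g p) (v : E) :
    pd v (fun q => f q * g q) p = pd v f p * g p + f p * pd v g p := by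
  simp [pd, fderiv_fun_mul hf hg, mul_comm, add_comm]

lemma pd_const_mul {A : Type*} [NormedCommRing A] [NormedAlgebra ℝ A] {f : E → A} {p : E}
    (hf : DifferentiableAt ℝ f p) (c : A) (v : E) :
    pd v (fun q => c * f q) p = c * pd v f p := by
  rw [pd_mul (differentiableAt_const c) hf, pd_const]
  simp

lemma pd_comp_clm {G : Type*} [NormedAddCommGroup G] [NormedSpace ℝ G] (L : F →L[ℝ] G)
    {f : E → F} {p : E} (hf : DifferentiableAt ℝ f p) (v : E) :
    pd v (fun q => L (f q)) p = L (pd v f p) := by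
  have := (L.hasFDerivAt.comp p hf.hasFDerivAt).fderiv
  simp only [Function.comp_def] at this
  simp [pd, this]

lemma pd_re {f : E → ℂ} {p : E} (hf : DifferentiableAt ℝ f p) (v : E) :
    pd v (fun q => (f q).re) p = (pd v f p).re :=
  pd_comp_clm Complex.reCLM hf v

lemma pd_im {f : E → ℂ} {p : E} (hf : DifferentiableAt ℝ f p) (v : E) :
    pd v (fun q => (f q).im) p = (pd v f p).im :=
  pd_comp_clm Complex.imCLM hf v

/-- Derivatives in constant directions commute. This carries independence of ψ or of x over from a
function to its derivatives. -/
lemma pd_pd_eq_zero (hM : IsOpen M) {f : E → F} (hf : ContDiffOn ℝ ∞ f M) {v : E}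
    (h : ∀ p ∈ M, pd v f p = 0) (w : E) {p : E} (hp : p ∈ M) : pd v (pd w f) p = 0 := by
  rw [pd_comm hM hf v w hp]
  exact pd_eq_zero_of_const hM h w hp

end DirectionalDerivative

/-! ### The prolongation formulas in terms of directional derivatives on the base. -/

section Prolongation

variable {n : ℕ} {M : Set (Base n)}

/-- The vector `∂_μ + ψ_μ ∂_ψ + ψ*_μ ∂_{ψ*}`. -/
abbrev tot (u : Fin (n + 1) → ℂ) (μ : Fin (n + 1)) : Base n := (Pi.single μ 1, u μ)

/-- The coordinate vector `∂_μ`. -/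
abbrev ez (μ : Fin (n + 1)) : Base n := (Pi.single μ 1, 0)

/-- The vertical vector `c ∂_ψ + c* ∂_{ψ*}`. -/
abbrev vert (c : ℂ) : Base n := (0, c)

lemma tot_eq (u : Fin (n + 1) → ℂ) (μ : Fin (n + 1)) : tot u μ = ez μ + vert (u μ) := by
  simp [tot, ez, vert]

/-- The function `S(t, x, |ψ|)` of `(t, x, ψ)`. -/
def potential (S : (Fin (n + 1) → ℝ) × ℝ → ℂ) (p : Base n) : ℂ := S (p.1, ‖p.2‖)

/-- `totalDeriv1 μ f` depends on the jet through the base point and, linearly, through ψ_μ. The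
first dependence gives a second derivative with both directions frozen, the second gives the term
with ψ_{νμ}. -/
lemma totalDeriv2_totalDeriv1 {F : Type*} [NormedAddCommGroup F] [NormedSpace ℝ F]
    (hM : IsOpen M) {f : Base n → F} (hf : ContDiffOn ℝ ∞ f M) (μ ν : Fin (n + 1)) {j : Jet2 n}
    (hj : j.1.1 ∈ M) :
    totalDeriv2 ν (totalDeriv1 μ f) j
      = pd (tot j.1.2 ν) (pd (tot j.1.2 μ) f) j.1.1 + pd (vert (j.2 ν μ)) f j.1.1 := by
  have hc := hf.contDiffAt (hM.mem_nhds hj)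
  have h1 : DifferentiableAt ℝ (fderiv ℝ f) j.1.1 :=
    (hc.fderiv_right (m := 1) (by norm_cast)).differentiableAt (by norm_num)
  have h2 : HasFDerivAt (fun i : Jet1 n => fderiv ℝ f i.1)
      ((fderiv ℝ (fderiv ℝ f) j.1.1).comp (ContinuousLinearMap.fst ℝ _ _)) j.1 :=
    h1.hasFDerivAt.comp j.1 hasFDerivAt_fst
  have h3 : HasFDerivAt (fun i : Jet1 n => ((Pi.single μ 1, i.2 μ) : Base n))
      ((0 : Jet1 n →L[ℝ] (Fin (n + 1) → ℝ)).prod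
        ((ContinuousLinearMap.proj μ).comp (ContinuousLinearMap.snd ℝ _ _))) j.1 :=
    (hasFDerivAt_const _ _).prodMk
      ((ContinuousLinearMap.proj (R := ℝ) (φ := fun _ : Fin (n + 1) => ℂ) μ).hasFDerivAt.comp j.1
        hasFDerivAt_snd)
  have h4 := (h2.clm_apply h3).fderiv
  have h5 : pd (tot j.1.2 ν) (pd (tot j.1.2 μ) f) j.1.1
      = fderiv ℝ (fderiv ℝ f) j.1.1 (tot j.1.2 ν) (tot j.1.2 μ) := by
    unfold pd
    rw [fderiv_clm_apply h1 (differentiableAt_const _)]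
    simp
  rw [h5]
  unfold totalDeriv2 totalDeriv1
  rw [h4]
  simp [pd, add_comm]

lemma totalDeriv2_prol1 (hM : IsOpen M) {Q : Base n → Base n} (hQ : ContDiffOn ℝ ∞ Q M)
    (μ ν : Fin (n + 1)) {j : Jet2 n} (hj : j.1.1 ∈ M) :
    totalDeriv2 ν (prol1 Q μ) j
      = pd (tot j.1.2 ν) (pd (tot j.1.2 μ) fun p => (Q p).2) j.1.1
        + pd (vert (j.2 ν μ)) (fun p => (Q p).2) j.1.1
        - ∑ κ, ((pd (tot j.1.2 ν) (pd (tot j.1.2 μ) fun p => (Q p).1 κ) j.1.1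
          + pd (vert (j.2 ν μ)) (fun p => (Q p).1 κ) j.1.1) • j.1.2 κ
          + pd (tot j.1.2 μ) (fun p => (Q p).1 κ) j.1.1 • j.2 ν κ) := by
  have hη : ContDiffOn ℝ ∞ (fun p => (Q p).2) M := contDiff_snd.comp_contDiffOn hQ
  have hξ : ∀ κ, ContDiffOn ℝ ∞ (fun p => (Q p).1 κ) M := fun κ =>
    contDiffOn_pi.1 (contDiff_fst.comp_contDiffOn hQ) κ
  have d1 := totalDeriv1_differentiableAt (j := j.1) (smooth_snd hM hQ hj) μ
  have d2 := fun κ => totalDeriv1_differentiableAt (j := j.1) (smooth_fst hM hQ κ hj) μ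
  have d3 : ∀ κ : Fin (n + 1), HasFDerivAt (fun i : Jet1 n => i.2 κ)
      ((ContinuousLinearMap.proj (R := ℝ) (φ := fun _ : Fin (n + 1) => ℂ) κ).comp
        (ContinuousLinearMap.snd ℝ _ _)) j.1 := fun κ =>
    (ContinuousLinearMap.proj (R := ℝ) (φ := fun _ : Fin (n + 1) => ℂ) κ).hasFDerivAt.comp j.1
        hasFDerivAt_snd
  have h := (d1.hasFDerivAt.sub (HasFDerivAt.fun_sum (u := Finset.univ) fun κ _ =>
    (d2 κ).hasFDerivAt.fun_smul (d3 κ))).fderiv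
  have e1 := totalDeriv2_totalDeriv1 hM hη μ ν hj
  have e2 := fun κ => totalDeriv2_totalDeriv1 hM (hξ κ) μ ν hj
  rw [← e1]
  simp only [← e2]
  have h' : fderiv ℝ (prol1 Q μ) j.1 = _ := h
  conv_lhs => unfold totalDeriv2
  rw [h']
  simp [totalDeriv2, pd, totalDeriv1, add_comm]

/-- The value of `Q_(2)` on the left-hand side of the equation, in terms of the coefficients
of `Q`. -/
lemma fderiv_eqn_prolong (hM : IsOpen M) {Q : Base n → Base n} (hQ : ContDiffOn ℝ ∞ Q M)
    {S : (Fin (n + 1) → ℝ) × ℝ → ℂ} (hS : ContDiffOn ℝ ∞ (potential S) M)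
    {p : Base n} (hp : p ∈ M) (u : Fin (n + 1) → ℂ) (U : Fin (n + 1) → Fin (n + 1) → ℂ) :
    fderiv ℝ (eqn S) ((p, u), U) (prolong Q ((p, u), U))
      = Complex.I * (pd (tot u 0) (fun p => (Q p).2) p
          - ∑ κ, pd (tot u 0) (fun p => (Q p).1 κ) p • u κ)
        + ∑ a : Fin n, (pd (tot u a.succ) (pd (tot u a.succ) fun p => (Q p).2) p
          + pd (vert (U a.succ a.succ)) (fun p => (Q p).2) p
          - ∑ κ, ((pd (tot u a.succ) (pd (tot u a.succ) fun p => (Q p).1 κ) p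
            + pd (vert (U a.succ a.succ)) (fun p => (Q p).1 κ) p) • u κ
            + pd (tot u a.succ) (fun p => (Q p).1 κ) p • (U a.succ κ + U κ a.succ)))
        + (pd (Q p) (potential S) p * p.2 + potential S p * (Q p).2) := by
  set j : Jet2 n := ((p, u), U) with hj
  -- Jet coordinates are linear functions, hence their own derivatives.
  have key : ∀ (L : Jet2 n →L[ℝ] ℂ) (f : Jet2 n → ℂ), (∀ i, f i = L i) → HasFDerivAt f L j := by
    intro L f h
    rw [funext h]
    exact L.hasFDerivAt
  have dS : HasFDerivAt (fun i : Jet2 n => potential S i.1.1)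
      ((fderiv ℝ (potential S) p).comp ((ContinuousLinearMap.fst ℝ _ _).comp
        (ContinuousLinearMap.fst ℝ _ _))) j :=
    (differentiableAt_of_smooth hM hS hp).hasFDerivAt.comp (f := fun i : Jet2 n => i.1.1) j
      (hasFDerivAt_fst.comp (f := fun i : Jet2 n => i.1) j hasFDerivAt_fst)
  have dψ : HasFDerivAt (fun i : Jet2 n => i.1.1.2)
      ((ContinuousLinearMap.snd ℝ _ _).comp ((ContinuousLinearMap.fst ℝ _ _).comp
        (ContinuousLinearMap.fst ℝ _ _))) j :=
    key _ _ fun _ => rfl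
  have du : HasFDerivAt (fun i : Jet2 n => i.1.2 0)
      ((ContinuousLinearMap.proj (R := ℝ) (φ := fun _ : Fin (n + 1) => ℂ) 0).comp
        ((ContinuousLinearMap.snd ℝ _ _).comp (ContinuousLinearMap.fst ℝ _ _))) j :=
    key _ _ fun _ => rfl
  have dU : ∀ a : Fin n, HasFDerivAt (fun i : Jet2 n => i.2 a.succ a.succ)
      ((ContinuousLinearMap.proj (R := ℝ) (φ := fun _ : Fin (n + 1) => ℂ) a.succ).comp
        ((ContinuousLinearMap.proj (R := ℝ) (φ := fun _ : Fin (n + 1) => Fin (n + 1) → ℂ)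
          a.succ).comp (ContinuousLinearMap.snd ℝ _ _))) j := fun a =>
    key _ _ fun _ => rfl
  have h := (((du.const_mul Complex.I).add (HasFDerivAt.fun_sum (u := Finset.univ)
    fun a _ => dU a)).add (dS.mul dψ)).fderiv
  have h' : fderiv ℝ (eqn S) j = _ := h
  rw [h']
  have hp2 : ∀ a : Fin n, prol2 Q a.succ a.succ j = _ := fun a => by
    rw [prol2, totalDeriv2_prol1 hM hQ a.succ a.succ (j := j) hp]
  simp only [prolong, add_apply, smul_apply,
    ContinuousLinearMap.comp_apply, sum_apply, ContinuousLinearMap.proj_apply,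
    ContinuousLinearMap.coe_fst', ContinuousLinearMap.coe_snd', hp2, smul_eq_mul]
  simp only [hj, prol1, totalDeriv1, pd, smul_add, Finset.sum_add_distrib]
  ring_nf

end Prolongation

/-! ### The invariance criterion at special jets. -/

section DeterminingEquations

variable {n : ℕ} {M : Set (Base n)} {s : Base n → ℂ} {Q : Base n → Base n}

/-- The value of `Q_(2)` on the left-hand side of the equation with the potential `s`, at the jet
`((p, u), U)`. -/
def critVal (s : Base n → ℂ) (Q : Base n → Base n) (p : Base n) (u : Fin (n + 1) → ℂ)
    (U : Fin (n + 1) → Fin (n + 1) → ℂ) : ℂ :=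
  Complex.I * (pd (tot u 0) (fun p => (Q p).2) p
      - ∑ κ, pd (tot u 0) (fun p => (Q p).1 κ) p • u κ)
    + ∑ a : Fin n, (pd (tot u a.succ) (pd (tot u a.succ) fun p => (Q p).2) p
      + pd (vert (U a.succ a.succ)) (fun p => (Q p).2) p
      - ∑ κ, ((pd (tot u a.succ) (pd (tot u a.succ) fun p => (Q p).1 κ) p
        + pd (vert (U a.succ a.succ)) (fun p => (Q p).1 κ) p) • u κ
        + pd (tot u a.succ) (fun p => (Q p).1 κ) p • (U a.succ κ + U κ a.succ)))
    + (pd (Q p) s p * p.2 + s p * (Q p).2)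

/-- The invariance criterion on `M` in terms of `critVal`. -/
def CritOn (M : Set (Base n)) (s : Base n → ℂ) (Q : Base n → Base n) : Prop :=
  ∀ p ∈ M, ∀ (u : Fin (n + 1) → ℂ) (U : Fin (n + 1) → Fin (n + 1) → ℂ),
    (∀ μ ν, U μ ν = U ν μ) →
    Complex.I * u 0 + ∑ a : Fin n, U a.succ a.succ + s p * p.2 = 0 → critVal s Q p u U = 0

lemma invCriterion_iff {Ω : Set ((Fin (n + 1) → ℝ) × ℝ)} (hM : IsOpen (dom Ω))
    (hQ : ContDiffOn ℝ ∞ Q (dom Ω)) {S : (Fin (n + 1) → ℝ) × ℝ → ℂ}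
    (hS : ContDiffOn ℝ ∞ (potential S) (dom Ω)) :
    InvCriterion Ω S Q ↔ CritOn (dom Ω) (potential S) Q := by
  constructor
  · intro h p hp u U hU he
    rw [critVal, ← fderiv_eqn_prolong hM hQ hS hp]
    exact h ((p, u), U) hp hU he
  · rintro h ⟨⟨p, u⟩, U⟩ hp hU he
    rw [fderiv_eqn_prolong hM hQ hS hp]
    exact h p hp u U hU he

/-- The coefficient `η_ψ` of `Q`. -/
def zetaOf (Q : Base n → Base n) : Base n → ℂ := pd (vert 1) fun p => (Q p).2

/-- The determining equations for `Q` that are equivalent to the invariance criterion. -/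
structure DetEqns (M : Set (Base n)) (s : Base n → ℂ) (Q : Base n → Base n) : Prop where
  tau_space : ∀ p ∈ M, ∀ a : Fin n, pd (ez a.succ) (fun p => (Q p).1 0) p = 0
  xi_vert : ∀ p ∈ M, ∀ (κ : Fin (n + 1)) (c : ℂ), pd (vert c) (fun p => (Q p).1 κ) p = 0
  killing : ∀ p ∈ M, ∀ a b : Fin n, pd (ez a.succ) (fun p => (Q p).1 b.succ) p
    + pd (ez b.succ) (fun p => (Q p).1 a.succ) p
      = if a = b then pd (ez 0) (fun p => (Q p).1 0) p else 0
  eta_vert : ∀ p ∈ M, ∀ c : ℂ, pd (vert c) (fun p => (Q p).2) p = c * zetaOf Q p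
  zeta_vert : ∀ p ∈ M, ∀ c : ℂ, pd (vert c) (zetaOf Q) p = 0
  zeta_space : ∀ p ∈ M, ∀ a : Fin n, 2 * pd (ez a.succ) (zetaOf Q) p
    = Complex.I * pd (ez 0) (fun p => (Q p).1 a.succ) p
      + (∑ b : Fin n, pd (ez b.succ) (pd (ez b.succ) fun p => (Q p).1 a.succ) p : ℝ)
  rest : ∀ p ∈ M, Complex.I * pd (ez 0) (fun p => (Q p).2) p
    + ∑ b : Fin n, pd (ez b.succ) (pd (ez b.succ) fun p => (Q p).2) p
    + (pd (ez 0) (fun p => (Q p).1 0) p - zetaOf Q p) * (s p * p.2)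
    + (pd (Q p) s p * p.2 + s p * (Q p).2) = 0

lemma pd_vert (f : Base n → ℂ) (p : Base n) (c : ℂ) :
    pd (vert c) f p = c.re * pd (vert 1) f p + c.im * pd (vert Complex.I) f p := by
  have : (vert c : Base n) = c.re • vert 1 + c.im • vert Complex.I := by
    simp [vert, Complex.re_add_im]
  rw [this, pd_add_dir, pd_smul_dir, pd_smul_dir]
  simp

lemma pd_vert_real (f : Base n → ℝ) (p : Base n) (c : ℂ) :
    pd (vert c) f p = c.re * pd (vert 1) f p + c.im * pd (vert Complex.I) f p := by
  have : (vert c : Base n) = c.re • vert 1 + c.im • vert Complex.I := by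
    simp [vert, Complex.re_add_im]
  rw [this, pd_add_dir, pd_smul_dir, pd_smul_dir]
  simp

lemma pd_vert_zero {F : Type*} [NormedAddCommGroup F] [NormedSpace ℝ F] (f : Base n → F)
    (p : Base n) : pd (vert 0) f p = 0 :=
  pd_zero_dir f p

/-- The second derivatives along `∂_μ + c ∂_ψ + c* ∂_{ψ*}`. -/
lemma pd_pd_tot {F : Type*} [NormedAddCommGroup F] [NormedSpace ℝ F] (hM : IsOpen M)
    {f : Base n → F} (hf : ContDiffOn ℝ ∞ f M) {p : Base n} (hp : p ∈ M) (u : Fin (n + 1) → ℂ)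
    (μ : Fin (n + 1)) :
    pd (tot u μ) (pd (tot u μ) f) p = pd (ez μ) (pd (ez μ) f) p
      + (2 : ℝ) • pd (ez μ) (pd (vert (u μ)) f) p + pd (vert (u μ)) (pd (vert (u μ)) f) p := by
  have h : ∀ q ∈ M, pd (tot u μ) f q = pd (ez μ) f q + pd (vert (u μ)) f q := fun q _ => by
    rw [tot_eq, pd_add_dir]
  rw [pd_congr hM h _ hp, tot_eq, pd_add_dir,
    pd_add (differentiableAt_of_smooth hM (pd_smooth hM hf _) hp)
      (differentiableAt_of_smooth hM (pd_smooth hM hf _) hp),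
    pd_add (differentiableAt_of_smooth hM (pd_smooth hM hf _) hp)
      (differentiableAt_of_smooth hM (pd_smooth hM hf _) hp),
    pd_comm hM hf (vert (u μ)) (ez μ) hp, two_smul]
  abel

lemma pd_tot_of_vert {F : Type*} [NormedAddCommGroup F] [NormedSpace ℝ F]
    {f : Base n → F} (h : ∀ p ∈ M, ∀ c : ℂ, pd (vert c) f p = 0) {p : Base n} (hp : p ∈ M)
    (u : Fin (n + 1) → ℂ) (μ : Fin (n + 1)) : pd (tot u μ) f p = pd (ez μ) f p := by
  rw [tot_eq, pd_add_dir, h p hp, add_zero]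

lemma pd_pd_tot_of_vert {F : Type*} [NormedAddCommGroup F] [NormedSpace ℝ F] (hM : IsOpen M)
    {f : Base n → F} (hf : ContDiffOn ℝ ∞ f M) (h : ∀ p ∈ M, ∀ c : ℂ, pd (vert c) f p = 0)
    {p : Base n} (hp : p ∈ M) (u : Fin (n + 1) → ℂ) (μ : Fin (n + 1)) :
    pd (tot u μ) (pd (tot u μ) f) p = pd (ez μ) (pd (ez μ) f) p := by
  rw [pd_pd_tot hM hf hp, pd_eq_zero_of_const hM (fun q hq => h q hq _) _ hp,
    pd_eq_zero_of_const hM (fun q hq => h q hq _) _ hp]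
  simp

/-- The form of `critVal` for coefficients `ξ` that do not depend on `ψ` and `η` with
`η_{ψ*} = 0`. -/
lemma critVal_of_projectable (hM : IsOpen M) (hQ : ContDiffOn ℝ ∞ Q M)
    (hτ : ∀ p ∈ M, ∀ a : Fin n, pd (ez a.succ) (fun p => (Q p).1 0) p = 0)
    (hξ : ∀ p ∈ M, ∀ (κ : Fin (n + 1)) (c : ℂ), pd (vert c) (fun p => (Q p).1 κ) p = 0)
    (hk : ∀ p ∈ M, ∀ a b : Fin n, pd (ez a.succ) (fun p => (Q p).1 b.succ) p
      + pd (ez b.succ) (fun p => (Q p).1 a.succ) p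
        = if a = b then pd (ez 0) (fun p => (Q p).1 0) p else 0)
    (hη : ∀ p ∈ M, ∀ c : ℂ, pd (vert c) (fun p => (Q p).2) p = c * zetaOf Q p)
    {p : Base n} (hp : p ∈ M) (u : Fin (n + 1) → ℂ) (U : Fin (n + 1) → Fin (n + 1) → ℂ)
    (he : Complex.I * u 0 + ∑ a : Fin n, U a.succ a.succ + s p * p.2 = 0) :
    critVal s Q p u U = Complex.I * pd (ez 0) (fun p => (Q p).2) p
      + ∑ b : Fin n, pd (ez b.succ) (pd (ez b.succ) fun p => (Q p).2) p
      + (pd (ez 0) (fun p => (Q p).1 0) p - zetaOf Q p) * (s p * p.2)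
      + (pd (Q p) s p * p.2 + s p * (Q p).2)
      + ∑ a : Fin n, (2 * pd (ez a.succ) (zetaOf Q) p
        - (Complex.I * pd (ez 0) (fun p => (Q p).1 a.succ) p
          + (∑ b : Fin n, pd (ez b.succ) (pd (ez b.succ) fun p => (Q p).1 a.succ) p : ℝ)))
        * u a.succ
      + ∑ a : Fin n, u a.succ * pd (vert (u a.succ)) (zetaOf Q) p := by
  have sη : ContDiffOn ℝ ∞ (fun p => (Q p).2) M := contDiff_snd.comp_contDiffOn hQ
  have sξ : ∀ κ, ContDiffOn ℝ ∞ (fun p => (Q p).1 κ) M := fun κ =>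
    contDiffOn_pi.1 (contDiff_fst.comp_contDiffOn hQ) κ
  have sζ : ContDiffOn ℝ ∞ (zetaOf Q) M := pd_smooth hM sη _
  have dζ := differentiableAt_of_smooth hM sζ hp
  have h0 : pd (tot u 0) (fun p => (Q p).2) p
      = pd (ez 0) (fun p => (Q p).2) p + u 0 * zetaOf Q p := by
    rw [tot_eq, pd_add_dir, hη p hp]
  have h1 : ∀ a : Fin n, pd (tot u a.succ) (pd (tot u a.succ) fun p => (Q p).2) p
      = pd (ez a.succ) (pd (ez a.succ) fun p => (Q p).2) p
        + 2 * pd (ez a.succ) (zetaOf Q) p * u a.succ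
        + u a.succ * pd (vert (u a.succ)) (zetaOf Q) p := by
    intro a
    rw [pd_pd_tot hM sη hp, pd_congr hM (fun q hq => hη q hq (u a.succ)) (ez a.succ) hp,
      pd_congr hM (fun q hq => hη q hq (u a.succ)) (vert (u a.succ)) hp,
      pd_const_mul dζ, pd_const_mul dζ, Complex.real_smul]
    push_cast
    ring
  have h2 : ∀ a : Fin n, ∀ κ, pd (tot u a.succ) (pd (tot u a.succ) fun p => (Q p).1 κ) p
      = pd (ez a.succ) (pd (ez a.succ) fun p => (Q p).1 κ) p := fun a κ =>
    pd_pd_tot_of_vert hM (sξ κ) (fun q hq c => hξ q hq κ c) hp u _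
  have h3 : ∀ μ κ, pd (tot u μ) (fun p => (Q p).1 κ) p = pd (ez μ) (fun p => (Q p).1 κ) p :=
    fun μ κ => pd_tot_of_vert (fun q hq c => hξ q hq κ c) hp u μ
  have h4 : ∀ a : Fin n, pd (ez a.succ) (pd (ez a.succ) fun p => (Q p).1 0) p = 0 := fun a =>
    pd_eq_zero_of_const hM (fun q hq => hτ q hq a) _ hp
  -- Only the symmetric part of ∂_aξ^b meets the symmetrised ψ_{ab}, and by `hk` it is τ_t/2 times
  -- the identity. So these terms see the second derivatives only through Σψ_{aa}.
  have h5 : ∑ a : Fin n, ∑ b : Fin n, ((pd (ez a.succ) (fun p => (Q p).1 b.succ) p : ℝ) : ℂ)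
        * (U a.succ b.succ + U b.succ a.succ)
      = (pd (ez 0) (fun p => (Q p).1 0) p : ℝ) * ∑ a : Fin n, U a.succ a.succ := by
    have e1 : ∑ a : Fin n, ∑ b : Fin n, ((pd (ez a.succ) (fun p => (Q p).1 b.succ) p : ℝ) : ℂ)
        * (U a.succ b.succ + U b.succ a.succ)
        = ∑ a : Fin n, ∑ b : Fin n, ((pd (ez a.succ) (fun p => (Q p).1 b.succ) p
          + pd (ez b.succ) (fun p => (Q p).1 a.succ) p : ℝ) : ℂ) * U a.succ b.succ := by
      simp only [Complex.ofReal_add, add_mul, mul_add, Finset.sum_add_distrib]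
      congr 1
      exact Finset.sum_comm
    rw [e1, Finset.mul_sum]
    refine Finset.sum_congr rfl fun a _ => ?_
    rw [Finset.sum_eq_single a]
    · simp [hk p hp]
    · intro b _ hb
      simp [hk p hp, hb.symm]
    · simp
  have h6 : ∑ a : Fin n, ∑ b : Fin n,
        ((pd (ez a.succ) (pd (ez a.succ) fun p => (Q p).1 b.succ) p : ℝ) : ℂ) * u b.succ
      = ∑ a : Fin n,
        ((∑ b : Fin n, pd (ez b.succ) (pd (ez b.succ) fun p => (Q p).1 a.succ) p : ℝ) : ℂ)
          * u a.succ := by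
    rw [Finset.sum_comm]
    simp only [Complex.ofReal_sum, Finset.sum_mul]
  simp only [critVal, h1, h2, h3, h4, hη p hp, hξ p hp, Fin.sum_univ_succ (n := n), hτ p hp,
    h0, add_zero, Complex.real_smul]
  simp only [Complex.ofReal_zero, zero_mul, zero_add, Finset.sum_add_distrib,
    Finset.sum_sub_distrib, sub_mul, add_mul, h5, h6, mul_assoc, ← Finset.mul_sum,
    ← Finset.sum_mul]
  -- What is left of ψ_t and the ψ_{aa} is (ζ - τ_t)(iψ_t + Σψ_{aa}), which the equation replaces by
  -- -(ζ - τ_t)Sψ.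
  linear_combination (zetaOf Q p - (pd (ez 0) (fun p => (Q p).1 0) p : ℝ)) * he

lemma DetEqns.critOn (hM : IsOpen M) (hQ : ContDiffOn ℝ ∞ Q M) (h : DetEqns M s Q) :
    CritOn M s Q := by
  intro p hp u U hU he
  rw [critVal_of_projectable hM hQ h.tau_space h.xi_vert h.killing h.eta_vert hp u U he,
    h.rest p hp]
  simp [h.zeta_vert p hp, h.zeta_space p hp]

/-- Second derivatives with zero spatial diagonal do not enter the equation. Subtracting the
criterion at the jet with the same u and no second derivatives isolates the terms linear in them. -/
lemma CritOn.offdiag (h : CritOn M s Q) {p : Base n} (hp : p ∈ M) (u : Fin (n + 1) → ℂ)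
    (hu : Complex.I * u 0 + s p * p.2 = 0) (U : Fin (n + 1) → Fin (n + 1) → ℂ)
    (hU : ∀ μ ν, U μ ν = U ν μ) (hd : ∀ a : Fin n, U a.succ a.succ = 0) :
    ∑ a : Fin n, ∑ κ, ((pd (tot u a.succ) (fun p => (Q p).1 κ) p : ℝ) : ℂ) * U a.succ κ = 0 := by
  have h1 := h p hp u U hU (by simp [hd, hu])
  have h0 := h p hp u (fun _ _ => 0) (fun _ _ => rfl) (by simp [hu])
  have hs : ∀ (a : Fin n) κ, U a.succ κ + U κ a.succ = 2 * U a.succ κ := fun a κ => by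
    rw [hU κ]; ring
  simp only [critVal, hd, hs, pd_vert_zero, Complex.real_smul, Finset.sum_add_distrib,
    Finset.sum_sub_distrib, add_zero, mul_zero, mul_left_comm _ (2 : ℂ),
    ← Finset.mul_sum] at h1 h0
  linear_combination (h0 - h1) / 2

/-- ψ_{ta} enters the criterion only with a multiple of D_aτ. Since ψ_a = c is arbitrary, this will
separate τ_a from the vertical derivatives of τ. -/
lemma CritOn.tau_tot (h : CritOn M s Q) {p : Base n} (hp : p ∈ M) (a : Fin n) (c : ℂ) :
    pd ((Pi.single a.succ 1, c) : Base n) (fun p => (Q p).1 0) p = 0 := by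
  -- When all ψ_{aa} vanish, the equation forces ψ_t = i s ψ.
  have h1 := h.offdiag hp (Fin.cons (Complex.I * (s p * p.2)) fun _ => c)
    (by simp [← mul_assoc]) (fun μ ν => (if μ = a.succ then if ν = 0 then 1 else 0 else 0)
      + (if μ = 0 then if ν = a.succ then 1 else 0 else 0))
    (fun μ ν => by by_cases h1 : μ = 0 <;> by_cases h2 : ν = 0 <;> simp [h1, h2, add_comm])
    (fun b => by simp [Fin.succ_ne_zero])
  simpa [Fin.succ_ne_zero, Fin.sum_univ_succ, tot] using h1

lemma CritOn.xi_offdiag (h : CritOn M s Q) {p : Base n} (hp : p ∈ M) {a b : Fin n}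
    (hab : a ≠ b) : pd (ez a.succ) (fun p => (Q p).1 b.succ) p
      + pd (ez b.succ) (fun p => (Q p).1 a.succ) p = 0 := by
  have h1 := h.offdiag hp (Fin.cons (Complex.I * (s p * p.2)) fun _ => 0)
    (by simp [← mul_assoc]) (fun μ ν => (if μ = a.succ then if ν = b.succ then 1 else 0 else 0)
      + (if μ = b.succ then if ν = a.succ then 1 else 0 else 0))
    (fun μ ν => by
      by_cases h1 : μ = a.succ <;> by_cases h2 : ν = b.succ <;> by_cases h3 : μ = b.succ <;>
      by_cases h4 : ν = a.succ <;> simp [h1, h2, h3, h4, hab, hab.symm])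
    (fun c => by
      by_cases h1 : c = a <;> by_cases h2 : c = b <;> simp [h1, h2, hab, hab.symm])
  have h2 : ((pd (ez a.succ) (fun p => (Q p).1 b.succ) p
      + pd (ez b.succ) (fun p => (Q p).1 a.succ) p : ℝ) : ℂ) = 0 := by
    simpa [Fin.succ_ne_zero, Fin.sum_univ_succ, tot, ez, mul_add, Finset.sum_add_distrib] using h1
  exact_mod_cast h2

/-- The terms of the criterion that are linear in `ψ_{aa}`. -/
lemma CritOn.diag (hM : IsOpen M) (hQ : ContDiffOn ℝ ∞ Q M) (h : CritOn M s Q)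
    (hτ : ∀ p ∈ M, ∀ a : Fin n, pd (ez a.succ) (fun p => (Q p).1 0) p = 0)
    (hτv : ∀ p ∈ M, ∀ c : ℂ, pd (vert c) (fun p => (Q p).1 0) p = 0)
    {p : Base n} (hp : p ∈ M) (a : Fin n) (w c : ℂ) :
    Complex.I * (pd (vert (Complex.I * c)) (fun p => (Q p).2) p
        - pd (vert (Complex.I * c)) (fun p => (Q p).1 a.succ) p * w)
      + (pd (ez 0) (fun p => (Q p).1 0) p : ℝ) * c
      + pd (vert c) (fun p => (Q p).2) p - pd (vert c) (fun p => (Q p).1 a.succ) p * w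
      - 2 * (pd (ez a.succ) (fun p => (Q p).1 a.succ) p
        + pd (vert w) (fun p => (Q p).1 a.succ) p : ℝ) * c = 0 := by
  have sξ : ∀ κ, ContDiffOn ℝ ∞ (fun p => (Q p).1 κ) M := fun κ =>
    contDiffOn_pi.1 (contDiff_fst.comp_contDiffOn hQ) κ
  -- ψ_{aa} = c is balanced by ψ_t = i(c + sψ), while ψ_a = w stays fixed. The difference between a
  -- general c and c = 0 keeps exactly the terms that depend on c.
  set u : ℂ → Fin (n + 1) → ℂ := fun c =>
    Fin.cons (Complex.I * (c + s p * p.2)) fun b => if b = a then w else 0 with hu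
  set U : ℂ → Fin (n + 1) → Fin (n + 1) → ℂ := fun c μ ν =>
    if μ = a.succ then if ν = a.succ then c else 0 else 0 with hU
  have hc : ∀ c, critVal s Q p (u c) (U c) = 0 := fun c => by
    refine h p hp _ _ (fun μ ν => ?_) ?_
    · by_cases h1 : μ = a.succ <;> by_cases h2 : ν = a.succ <;> simp [hU, h1, h2]
    · simp only [hu, hU, Fin.cons_zero, Fin.succ_inj, Finset.sum_ite_eq', Finset.mem_univ, if_true,
        ← mul_assoc, Complex.I_mul_I]
      simp
  have t1 : ∀ c (b : Fin n), tot (u c) b.succ = tot (u 0) b.succ := fun c b => by simp [hu, tot]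
  have t2 : ∀ c κ, pd (tot (u c) 0) (fun p => (Q p).1 κ) p = pd (ez 0) (fun p => (Q p).1 κ) p
      + pd (vert (Complex.I * c)) (fun p => (Q p).1 κ) p
      + pd (vert (Complex.I * (s p * p.2))) (fun p => (Q p).1 κ) p := fun c κ => by
    rw [add_assoc, ← pd_add_dir, ← pd_add_dir]
    simp [hu, tot, ez, vert, mul_add]
  have t3 : ∀ c, pd (tot (u c) 0) (fun p => (Q p).2) p = pd (ez 0) (fun p => (Q p).2) p
      + pd (vert (Complex.I * c)) (fun p => (Q p).2) p
      + pd (vert (Complex.I * (s p * p.2))) (fun p => (Q p).2) p := fun c => by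
    rw [add_assoc, ← pd_add_dir, ← pd_add_dir]
    simp [hu, tot, ez, vert, mul_add]
  have t4 : ∀ b, pd (tot (u 0) b) (fun p => (Q p).1 0) p = pd (ez b) (fun p => (Q p).1 0) p :=
    fun b => pd_tot_of_vert hτv hp (u 0) b
  have t5 : ∀ b : Fin n, pd (tot (u 0) b.succ) (pd (tot (u 0) b.succ) fun p => (Q p).1 0) p = 0 :=
    fun b => by
      rw [pd_pd_tot_of_vert hM (sξ 0) hτv hp,
        pd_eq_zero_of_const hM (fun q hq => hτ q hq b) _ hp]
  have t6 : pd (tot (u 0) a.succ) (fun p => (Q p).1 a.succ) p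
      = pd (ez a.succ) (fun p => (Q p).1 a.succ) p + pd (vert w) (fun p => (Q p).1 a.succ) p := by
    rw [tot_eq, pd_add_dir]
    simp [hu]
  have uv : ∀ c (b : Fin n), u c b.succ = if b = a then w else 0 := fun c b => by simp [hu]
  have u0 : ∀ c, u c 0 = Complex.I * (c + s p * p.2) := fun c => by simp [hu]
  have U0 : ∀ c (b : Fin n), U c b.succ b.succ = if b = a then c else 0 := fun c b => by
    by_cases hb : b = a <;> simp [hU, hb]
  have hsum : ∀ c, critVal s Q p (u c) (U c)
      = Complex.I * (pd (ez 0) (fun p => (Q p).2) p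
          + pd (vert (Complex.I * c)) (fun p => (Q p).2) p
          + pd (vert (Complex.I * (s p * p.2))) (fun p => (Q p).2) p
          - ((pd (ez 0) (fun p => (Q p).1 0) p : ℝ) * (Complex.I * (c + s p * p.2))
            + (pd (ez 0) (fun p => (Q p).1 a.succ) p
              + pd (vert (Complex.I * c)) (fun p => (Q p).1 a.succ) p
              + pd (vert (Complex.I * (s p * p.2))) (fun p => (Q p).1 a.succ) p : ℝ) * w))
        + (∑ b : Fin n, pd (tot (u 0) b.succ) (pd (tot (u 0) b.succ) fun p => (Q p).2) p
          + pd (vert c) (fun p => (Q p).2) p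
          - ((∑ b : Fin n, pd (tot (u 0) b.succ) (pd (tot (u 0) b.succ)
                fun p => (Q p).1 a.succ) p : ℝ) * w
            + pd (vert c) (fun p => (Q p).1 a.succ) p * w
            + 2 * (pd (ez a.succ) (fun p => (Q p).1 a.succ) p
              + pd (vert w) (fun p => (Q p).1 a.succ) p : ℝ) * c))
        + (pd (Q p) s p * p.2 + s p * (Q p).2) := by
    intro c
    have v1 : ∑ b : Fin n, pd (vert (if b = a then c else 0)) (fun p => (Q p).2) p
        = pd (vert c) (fun p => (Q p).2) p := by
      rw [Finset.sum_eq_single a (fun b _ hb => by simp [hb, pd_vert_zero]) (by simp)]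
      simp
    have v2 : ∑ b : Fin n, pd (vert (if b = a then c else 0)) (fun p => (Q p).1 a.succ) p
        = pd (vert c) (fun p => (Q p).1 a.succ) p := by
      rw [Finset.sum_eq_single a (fun b _ hb => by simp [hb, pd_vert_zero]) (by simp)]
      simp
    have v3 : ∑ b : Fin n, ∑ d : Fin n,
        ((pd (tot (u 0) b.succ) (fun p => (Q p).1 d.succ) p : ℝ) : ℂ)
          * (U c b.succ d.succ + U c d.succ b.succ)
        = 2 * (pd (ez a.succ) (fun p => (Q p).1 a.succ) p
              + pd (vert w) (fun p => (Q p).1 a.succ) p : ℝ) * c := by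
      rw [← t6, Finset.sum_eq_single a, Finset.sum_eq_single a]
      · simp only [hU, if_true]
        ring
      · intro d _ hd
        simp [hU, hd]
      · simp
      · intro b _ hb
        simp [hU, hb]
      · simp
    have v4 : ∀ b : Fin n, U c b.succ 0 + U c 0 b.succ = 0 := fun b => by
      simp [hU, (Fin.succ_ne_zero _).symm]
    rw [critVal]
    simp only [t1 c, t2, t3, t5, t4, Fin.sum_univ_succ (n := n), hτ p hp, hτv p hp, U0, uv, u0, v4,
      Complex.real_smul, Finset.sum_add_distrib, Finset.sum_sub_distrib, v3]
    simp only [mul_ite, mul_zero, Finset.sum_ite_eq', Finset.mem_univ, if_true, ← Finset.sum_mul,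
      ← v1, ← v2]
    push_cast
    simp only [zero_mul, Finset.sum_const_zero, Finset.sum_add_distrib, add_mul]
    ring
  have e1 := hc c
  have e0 := hc 0
  rw [hsum] at e1 e0
  simp only [mul_zero, pd_vert_zero] at e0
  push_cast at e1 e0 ⊢
  linear_combination e1 - e0 + (pd (ez 0) (fun p => (Q p).1 0) p : ℝ) * c * Complex.I_mul_I

end DeterminingEquations

/-! ### From the criterion to the determining equations. -/

section DeterminingEquations

variable {n : ℕ} {M : Set (Base n)} {s : Base n → ℂ} {Q : Base n → Base n}

lemma CritOn.detEqns (hn : 1 ≤ n) (hM : IsOpen M) (hQ : ContDiffOn ℝ ∞ Q M) (h : CritOn M s Q) :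
    DetEqns M s Q := by
  have hτ : ∀ p ∈ M, ∀ a : Fin n, pd (ez a.succ) (fun p => (Q p).1 0) p = 0 :=
    fun p hp a => h.tau_tot hp a 0
  have hτv : ∀ p ∈ M, ∀ c : ℂ, pd (vert c) (fun p => (Q p).1 0) p = 0 := by
    intro p hp c
    -- Here n ≥ 1 is essential: some spatial direction must exist for ψ_{ta} to detect the vertical
    -- derivatives of τ.
    have h1 := h.tau_tot hp ⟨0, hn⟩ c
    have h2 := tot_eq (n := n) (fun _ => c) (Fin.succ ⟨0, hn⟩)
    rw [tot] at h2
    rwa [h2, pd_add_dir, hτ p hp, zero_add] at h1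
  have hd := fun p hp a w c => CritOn.diag hM hQ h hτ hτv (p := p) hp a w c
  have hsplit : ∀ p ∈ M, ∀ a : Fin n,
      (pd (ez 0) (fun p => (Q p).1 0) p = 2 * pd (ez a.succ) (fun p => (Q p).1 a.succ) p) ∧
      pd (vert Complex.I) (fun p => (Q p).2) p
        = Complex.I * pd (vert 1) (fun p => (Q p).2) p := by
    intro p hp a
    -- With w = 0 the relation is real-linear in c. Its values at 1 and i separate the ℂ-linear
    -- part, which gives τ_t = 2∂_aξ^a, from the antilinear part, which gives η_{ψ*} = 0.
    have e1 := hd p hp a 0 1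
    have e2 := hd p hp a 0 Complex.I
    have e3 : pd (vert (Complex.I * Complex.I)) (fun p => (Q p).2) p
        = - pd (vert 1) (fun p => (Q p).2) p := by
      rw [pd_vert]; simp
    simp only [e3, mul_zero, sub_zero, pd_vert_zero, mul_one, add_zero] at e1 e2
    set L1 := pd (vert 1) (fun p => (Q p).2) p
    set LI := pd (vert Complex.I) (fun p => (Q p).2) p
    set T := pd (ez 0) (fun p => (Q p).1 0) p
    set X := pd (ez a.succ) (fun p => (Q p).1 a.succ) p
    have hI := Complex.I_mul_I
    have k1 : ((T - 2 * X : ℝ) : ℂ) = 0 := by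
      push_cast
      linear_combination (e1 - Complex.I * e2) / 2 + (-L1 + T - 2 * X) / 2 * hI
    constructor
    · have : T - 2 * X = 0 := by exact_mod_cast k1
      linarith
    · push_cast at k1
      linear_combination -Complex.I * e1 + Complex.I * k1 + LI * hI
  have hη : ∀ p ∈ M, ∀ c : ℂ, pd (vert c) (fun p => (Q p).2) p = c * zetaOf Q p := by
    intro p hp c
    rw [pd_vert, (hsplit p hp ⟨0, hn⟩).2, zetaOf]
    conv_rhs => rw [← Complex.re_add_im c]
    ring
  have hξ' : ∀ p ∈ M, ∀ (a : Fin n) (c : ℂ), pd (vert c) (fun p => (Q p).1 a.succ) p = 0 := by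
    intro p hp a c
    -- For w = c = 1 the ζ terms cancel. As ξ^a is real, the real and imaginary parts yield its two
    -- vertical derivatives separately.
    have e1 := hd p hp a 1 1
    simp only [hη p hp, mul_one, (hsplit p hp a).1] at e1
    set l1 := pd (vert 1) (fun p => (Q p).1 a.succ) p
    set lI := pd (vert Complex.I) (fun p => (Q p).1 a.succ) p
    have e2 : ((3 * l1 : ℝ) : ℂ) + (lI : ℝ) * Complex.I = 0 := by
      push_cast at e1 ⊢
      linear_combination -e1 + zetaOf Q p * Complex.I_mul_I
    have r1 : l1 = 0 := by simpa using congrArg Complex.re e2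
    have r2 : lI = 0 := by simpa using congrArg Complex.im e2
    rw [pd_vert_real]
    simp [show pd (vert 1) (fun p => (Q p).1 a.succ) p = 0 from r1,
      show pd (vert Complex.I) (fun p => (Q p).1 a.succ) p = 0 from r2]
  have hξ : ∀ p ∈ M, ∀ (κ : Fin (n + 1)) (c : ℂ), pd (vert c) (fun p => (Q p).1 κ) p = 0 :=
    fun p hp κ c => by
      refine Fin.cases (hτv p hp c) (fun a => hξ' p hp a c) κ
  have hk : ∀ p ∈ M, ∀ a b : Fin n, pd (ez a.succ) (fun p => (Q p).1 b.succ) p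
      + pd (ez b.succ) (fun p => (Q p).1 a.succ) p
        = if a = b then pd (ez 0) (fun p => (Q p).1 0) p else 0 := by
    intro p hp a b
    by_cases hab : a = b
    · subst hab
      rw [if_pos rfl, (hsplit p hp a).1, two_mul]
    · rw [if_neg hab, h.xi_offdiag hp hab]
  -- Jets whose only spatial derivative is ψ_a = w and whose second derivatives vanish. The
  -- criterion becomes a constant, plus a ℂ-linear term in w, plus w times the derivative of ζ along
  -- w, which is even in w. The values at 0, w and -w separate the three.
  have hw : ∀ p ∈ M, ∀ (a : Fin n) (w : ℂ), _ := fun p hp a w =>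
    (critVal_of_projectable hM hQ hτ hξ hk hη hp (s := s)
      (Fin.cons (Complex.I * (s p * p.2)) fun b => if b = a then w else 0) (fun _ _ => 0)
      (by simp [← mul_assoc])).symm.trans
      (h p hp _ _ (fun _ _ => rfl) (by simp [← mul_assoc]))
  have hv : ∀ p (a : Fin n) (w : ℂ), ∑ b : Fin n, (if b = a then w else 0)
      * pd (vert (if b = a then w else 0)) (zetaOf Q) p = w * pd (vert w) (zetaOf Q) p := by
    intro p a w
    rw [Finset.sum_eq_single a (fun b _ hb => by simp [hb]) (by simp)]
    simp
  simp only [Fin.cons_succ, mul_ite, mul_zero, Finset.sum_ite_eq', Finset.mem_univ, if_true,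
    hv] at hw
  have hneg : ∀ p (w : ℂ), pd (vert (-w)) (zetaOf Q) p = - pd (vert w) (zetaOf Q) p := by
    intro p w
    rw [pd_vert, pd_vert (c := w)]
    simp
    ring
  have h0 : ∀ p ∈ M, _ := fun p hp => hw p hp ⟨0, hn⟩ 0
  simp only [mul_zero, zero_mul, add_zero] at h0
  have hz : ∀ p ∈ M, ∀ w : ℂ, pd (vert w) (zetaOf Q) p = 0 := by
    intro p hp w
    by_cases hw0 : w = 0
    · rw [hw0, pd_vert_zero]
    have e1 := hw p hp ⟨0, hn⟩ w
    have e2 := hw p hp ⟨0, hn⟩ (-w)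
    rw [hneg] at e2
    have e3 : w * pd (vert w) (zetaOf Q) p = 0 := by
      linear_combination (e1 + e2) / 2 - h0 p hp
    exact (mul_eq_zero.1 e3).resolve_left hw0
  refine ⟨hτ, hξ, hk, hη, hz, fun p hp a => ?_, h0⟩
  have e1 := hw p hp a 1
  rw [hz p hp] at e1
  linear_combination e1 - h0 p hp

end DeterminingEquations

/-! ### Phase rotations and derivatives of S(t, x, |ψ|). -/

section Potential

variable {n : ℕ} {Ω : Set ((Fin (n + 1) → ℝ) × ℝ)} {S : (Fin (n + 1) → ℝ) × ℝ → ℂ}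

lemma snd_ne_zero_of_mem_dom (hΩ : IsDomainRho Ω) {p : Base n} (hp : p ∈ dom Ω) : p.2 ≠ 0 :=
  norm_pos_iff.1 (hΩ.rho_pos _ hp)

lemma rotate_mem_dom {p : Base n} (hp : p ∈ dom Ω) {e : ℂ} (he : ‖e‖ = 1) :
    ((p.1, e * p.2) : Base n) ∈ dom Ω := by
  simpa [dom, he] using hp

lemma potential_smooth (hΩ : IsDomainRho Ω) (hS : ContDiffOn ℝ ∞ S Ω) :
    ContDiffOn ℝ ∞ (potential S) (dom Ω) := by
  intro p hp
  have h1 : ContDiffAt ℝ ∞ (fun p : Base n => (p.1, ‖p.2‖)) p :=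
    contDiffAt_fst.prodMk (contDiffAt_snd.norm ℝ (snd_ne_zero_of_mem_dom hΩ hp))
  have h2 : ContDiffAt ℝ ∞ S (p.1, ‖p.2‖) := hS.contDiffAt (hΩ.isOpen.mem_nhds hp)
  exact (h2.comp p h1).contDiffWithinAt

lemma potential_rotate (S : (Fin (n + 1) → ℝ) × ℝ → ℂ) (p : Base n) {e : ℂ} (he : ‖e‖ = 1) :
    potential S (p.1, e * p.2) = potential S p := by
  simp [potential, he]

lemma pd_potential_rotate (hΩ : IsDomainRho Ω) (hS : ContDiffOn ℝ ∞ S Ω) {p : Base n}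
    (hp : p ∈ dom Ω) {e : ℂ} (he : ‖e‖ = 1) (w : Fin (n + 1) → ℝ) (c : ℂ) :
    pd (w, e * c) (potential S) (p.1, e * p.2) = pd (w, c) (potential S) p := by
  have hd := differentiableAt_of_smooth (isOpen_dom hΩ.isOpen) (potential_smooth hΩ hS)
    (rotate_mem_dom hp he)
  let R : Base n →L[ℝ] Base n := (ContinuousLinearMap.fst ℝ _ _).prod
    ((ContinuousLinearMap.mul ℝ ℂ e).comp (ContinuousLinearMap.snd ℝ _ _))
  have h1 : HasFDerivAt (fun q => potential S (R q)) _ p :=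
    HasFDerivAt.comp p (g := potential S) hd.hasFDerivAt R.hasFDerivAt
  have h2 : (fun q => potential S (R q)) = potential S :=
    funext fun q => potential_rotate S q he
  rw [h2] at h1
  unfold pd
  rw [h1.fderiv]
  rfl

lemma hasDerivAt_circle (p : Base n) (t : ℝ) :
    HasDerivAt (fun t : ℝ => ((p.1, Complex.exp (t * Complex.I) * p.2) : Base n))
      (vert (Complex.I * (Complex.exp (t * Complex.I) * p.2))) t := by
  refine (hasDerivAt_const t p.1).prodMk ?_
  have h1 : HasDerivAt (fun t : ℝ => (t : ℂ) * Complex.I) Complex.I t := by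
    simpa using (Complex.ofRealCLM.hasDerivAt (x := t)).mul_const Complex.I
  have h2 := h1.cexp.mul_const p.2
  rwa [mul_comm (Complex.exp _) Complex.I, mul_assoc] at h2

/-- The fibre of `dom Ω` over z may be disconnected, because the admissible radii may have gaps, so
f need not be constant on it. But the fibre contains the whole circle through ψ, and f has zero
derivative along that circle. -/
lemma eq_of_pd_vert_eq_zero {F : Type*} [NormedAddCommGroup F] [NormedSpace ℝ F]
    (hΩ : IsOpen Ω) {f : Base n → F} (hf : ContDiffOn ℝ ∞ f (dom Ω))
    (h : ∀ p ∈ dom Ω, ∀ c : ℂ, pd (vert c) f p = 0) {p : Base n} (hp : p ∈ dom Ω) {e : ℂ}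
    (he : ‖e‖ = 1) : f (p.1, e * p.2) = f p := by
  have hm : ∀ t : ℝ, ((p.1, Complex.exp (t * Complex.I) * p.2) : Base n) ∈ dom Ω := fun t =>
    rotate_mem_dom hp (Complex.norm_exp_ofReal_mul_I t)
  have hd : ∀ t : ℝ, HasDerivAt (fun t : ℝ => f (p.1, Complex.exp (t * Complex.I) * p.2)) 0 t := by
    intro t
    have h1 := (differentiableAt_of_smooth (isOpen_dom hΩ) hf (hm t)).hasFDerivAt.comp_hasDerivAt t
      (hasDerivAt_circle p t)
    have h2 := h _ (hm t) (Complex.I * (Complex.exp (t * Complex.I) * p.2))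
    rw [pd] at h2
    rwa [h2] at h1
  have hc := is_const_of_deriv_eq_zero (fun t => (hd t).differentiableAt)
    (fun t => (hd t).deriv) e.arg 0
  have he' : Complex.exp (e.arg * Complex.I) = e := by
    simpa [he] using Complex.norm_mul_exp_arg_mul_I e
  simpa [he'] using hc

lemma pd_potential_angular (hΩ : IsDomainRho Ω) (hS : ContDiffOn ℝ ∞ S Ω) {p : Base n}
    (hp : p ∈ dom Ω) : pd (vert (Complex.I * p.2)) (potential S) p = 0 := by
  have hd := differentiableAt_of_smooth (isOpen_dom hΩ.isOpen) (potential_smooth hΩ hS) hp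
  have hd' : HasFDerivAt (potential S) (fderiv ℝ (potential S) p)
      ((p.1, Complex.exp ((0 : ℝ) * Complex.I) * p.2) : Base n) := by
    simpa using hd.hasFDerivAt
  have h1 := hd'.comp_hasDerivAt (0 : ℝ) (hasDerivAt_circle p 0)
  have h2 : (potential S ∘ fun t : ℝ => ((p.1, Complex.exp (t * Complex.I) * p.2) : Base n))
      = fun _ => potential S p :=
    funext fun t => potential_rotate S p (Complex.norm_exp_ofReal_mul_I t)
  rw [h2] at h1
  have h3 := h1.unique (hasDerivAt_const (0 : ℝ) (potential S p))
  simpa [pd] using h3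

/-- The function `ρ S_ρ`, as the derivative of the potential along the radial field. -/
def radial (s : Base n → ℂ) (p : Base n) : ℂ := pd (vert p.2) s p

lemma radial_potential (hΩ : IsDomainRho Ω) (hS : ContDiffOn ℝ ∞ S Ω) {p : Base n}
    (hp : p ∈ dom Ω) : radial (potential S) p = ‖p.2‖ * derivRho S (p.1, ‖p.2‖) := by
  have hd := differentiableAt_of_smooth (isOpen_dom hΩ.isOpen) (potential_smooth hΩ hS) hp
  have hd' : HasFDerivAt (potential S) (fderiv ℝ (potential S) p)
      ((p.1, ((1 : ℝ) : ℂ) * p.2) : Base n) := by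
    simpa using hd.hasFDerivAt
  have hcurve : HasDerivAt (fun t : ℝ => ((p.1, (t : ℂ) * p.2) : Base n)) (vert p.2) 1 := by
    refine (hasDerivAt_const (1 : ℝ) p.1).prodMk ?_
    simpa using (Complex.ofRealCLM.hasDerivAt (x := (1 : ℝ))).mul_const p.2
  have h1 := hd'.comp_hasDerivAt (1 : ℝ) hcurve
  have hSd : DifferentiableAt ℝ S (p.1, ‖p.2‖) := differentiableAt_of_smooth hΩ.isOpen hS hp
  have hr : HasDerivAt (fun r : ℝ => S (p.1, r)) (derivRho S (p.1, ‖p.2‖)) ‖p.2‖ := by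
    refine DifferentiableAt.hasDerivAt ?_
    exact DifferentiableAt.comp (f := fun r : ℝ => (p.1, r)) ‖p.2‖ hSd (by fun_prop)
  have hr' : HasDerivAt (fun r : ℝ => S (p.1, r)) (derivRho S (p.1, ‖p.2‖)) ((1 : ℝ) * ‖p.2‖) := by
    simpa using hr
  have h2 := hr'.scomp (1 : ℝ) ((hasDerivAt_id (1 : ℝ)).mul_const ‖p.2‖)
  have h3 : (potential S ∘ fun t : ℝ => ((p.1, (t : ℂ) * p.2) : Base n))
      =ᶠ[nhds 1] ((fun r : ℝ => S (p.1, r)) ∘ fun t : ℝ => id t * ‖p.2‖) := by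
    filter_upwards [lt_mem_nhds (zero_lt_one (α := ℝ))] with t ht
    simp [potential, abs_of_pos ht]
  have h4 := (h1.congr_of_eventuallyEq h3.symm).unique h2
  simpa [radial, pd] using h4

lemma base_eq_sum (w : Fin (n + 1) → ℝ) (c : ℂ) :
    ((w, c) : Base n) = ∑ μ, w μ • ez μ + vert c := by
  refine Prod.ext ?_ ?_
  · have := pi_eq_sum_univ' w
    simp only [Prod.fst_add, Prod.fst_sum, Prod.smul_fst, add_zero]
    conv_lhs => rw [this]
  · simp [Prod.snd_sum]

lemma pd_eq_sum {F : Type*} [NormedAddCommGroup F] [NormedSpace ℝ F] (f : Base n → F)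
    (v p : Base n) : pd v f p = ∑ μ, v.1 μ • pd (ez μ) f p + pd (vert v.2) f p := by
  have h : v = ∑ μ, v.1 μ • ez μ + vert v.2 := base_eq_sum v.1 v.2
  conv_lhs => rw [h]
  simp only [pd, map_add, map_sum, map_smul]

/-- The vertical vector gψ has the radial part (Re g)ψ and the angular part (Im g)iψ; the latter
preserves |ψ| and contributes nothing. -/
lemma pd_potential (hΩ : IsDomainRho Ω) (hS : ContDiffOn ℝ ∞ S Ω) {p : Base n}
    (hp : p ∈ dom Ω) (v : Base n) {g : ℂ} (hg : v.2 = g * p.2) :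
    pd v (potential S) p = ∑ μ, v.1 μ * pd (ez μ) (potential S) p
      + g.re * radial (potential S) p := by
  have h1 : (vert v.2 : Base n) = g.re • vert p.2 + g.im • vert (Complex.I * p.2) := by
    refine Prod.ext (by simp) ?_
    simp only [hg, Prod.snd_add, Prod.smul_snd, Complex.real_smul]
    conv_lhs => rw [← Complex.re_add_im g]
    ring
  rw [pd_eq_sum, h1, pd_add_dir, pd_smul_dir, pd_smul_dir, pd_potential_angular hΩ hS hp]
  simp [radial]

end Potential

/-! ### The classifying equation and the vanishing of η⁰. -/

section Classifying

variable {n : ℕ} {Ω : Set ((Fin (n + 1) → ℝ) × ℝ)} {S : (Fin (n + 1) → ℝ) × ℝ → ℂ}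
  {Q : Base n → Base n}

/-- The left-hand side of the classifying equation for a vector field with `η = ζ ψ`. -/
def classVal (s : Base n → ℂ) (Q : Base n → Base n) (p : Base n) : ℂ :=
  Complex.I * pd (ez 0) (zetaOf Q) p + ∑ b : Fin n, pd (ez b.succ) (pd (ez b.succ) (zetaOf Q)) p
    + pd (ez 0) (fun p => (Q p).1 0) p * s p + ∑ μ, (Q p).1 μ * pd (ez μ) s p
    + (zetaOf Q p).re * radial s p

lemma pd_ez_snd (μ : Fin (n + 1)) (p : Base n) : pd (ez μ) (fun p : Base n => p.2) p = 0 :=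
  pd_clm (ContinuousLinearMap.snd ℝ _ _) (ez μ) p

lemma pd_vert_snd (c : ℂ) (p : Base n) : pd (vert c) (fun p : Base n => p.2) p = c :=
  pd_clm (ContinuousLinearMap.snd ℝ _ _) (vert c) p

lemma snd_smooth {M : Set (Base n)} : ContDiffOn ℝ ∞ (fun p : Base n => p.2) M :=
  contDiff_snd.contDiffOn

/-- The left-hand side of the last determining equation for `η = ζ ψ + η⁰`. -/
lemma rest_eq (hΩ : IsDomainRho Ω) (hS : ContDiffOn ℝ ∞ S Ω) (hQ : ContDiffOn ℝ ∞ Q (dom Ω))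
    {p : Base n} (hp : p ∈ dom Ω) :
    Complex.I * pd (ez 0) (fun p => (Q p).2) p
      + ∑ b : Fin n, pd (ez b.succ) (pd (ez b.succ) fun p => (Q p).2) p
      + (pd (ez 0) (fun p => (Q p).1 0) p - zetaOf Q p) * (potential S p * p.2)
      + (pd (Q p) (potential S) p * p.2 + potential S p * (Q p).2)
      = classVal (potential S) Q p * p.2
        + (Complex.I * pd (ez 0) (fun p => (Q p).2 - zetaOf Q p * p.2) p
          + ∑ b : Fin n, pd (ez b.succ) (pd (ez b.succ) fun p => (Q p).2 - zetaOf Q p * p.2) p)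
        + potential S p * ((Q p).2 - zetaOf Q p * p.2)
        + (((Q p).2 - zetaOf Q p * p.2) / p.2).re * radial (potential S) p * p.2 := by
  have hM := isOpen_dom hΩ.isOpen
  have sη : ContDiffOn ℝ ∞ (fun p => (Q p).2) (dom Ω) := contDiff_snd.comp_contDiffOn hQ
  have sζ : ContDiffOn ℝ ∞ (zetaOf Q) (dom Ω) := pd_smooth hM sη _
  have h0 := snd_ne_zero_of_mem_dom hΩ hp
  have d1 : ∀ μ, ∀ q ∈ dom Ω, pd (ez μ) (fun p => (Q p).2 - zetaOf Q p * p.2) q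
      = pd (ez μ) (fun p => (Q p).2) q - pd (ez μ) (zetaOf Q) q * q.2 := by
    intro μ q hq
    rw [pd_sub (differentiableAt_of_smooth hM sη hq)
      (differentiableAt_of_smooth hM (sζ.mul snd_smooth) hq),
      pd_mul (differentiableAt_of_smooth hM sζ hq) (differentiableAt_of_smooth hM snd_smooth hq),
      pd_ez_snd]
    simp
  have d2 : ∀ μ, pd (ez μ) (pd (ez μ) (fun p => (Q p).2 - zetaOf Q p * p.2)) p
      = pd (ez μ) (pd (ez μ) (fun p => (Q p).2)) p - pd (ez μ) (pd (ez μ) (zetaOf Q)) p * p.2 := by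
    intro μ
    rw [pd_congr hM (d1 μ) _ hp, pd_sub (differentiableAt_of_smooth hM (pd_smooth hM sη _) hp)
      (differentiableAt_of_smooth hM ((pd_smooth hM sζ _).mul snd_smooth) hp),
      pd_mul (differentiableAt_of_smooth hM (pd_smooth hM sζ _) hp)
        (differentiableAt_of_smooth hM snd_smooth hp), pd_ez_snd]
    simp
  have e1 := pd_potential hΩ hS hp (Q p)
    (g := zetaOf Q p + ((Q p).2 - zetaOf Q p * p.2) / p.2) (by field_simp; ring)
  rw [e1, Complex.add_re]
  simp only [d1 0 p hp, d2, classVal, Finset.sum_sub_distrib, ← Finset.sum_mul]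
  push_cast
  ring

/-- Everything but ψ itself is unchanged under ψ ↦ eψ with |e| = 1. With C the classifying
expression, h = η⁰/ψ and B collecting the terms free of e, the last determining equation reads C eψ
+ B + Re(h/e) ρS_ρ eψ = 0. Both B and the last term are even in e, so e = ±1 give C = 0. Then e = 1
and e = i together give ρS_ρ times the conjugate of h equal to 0. -/
lemma DetEqns.classVal_and_radial (hΩ : IsDomainRho Ω) (hS : ContDiffOn ℝ ∞ S Ω)
    (hQ : ContDiffOn ℝ ∞ Q (dom Ω))
    (h : DetEqns (dom Ω) (potential S) Q) {p : Base n}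
    (hp : p ∈ dom Ω) : classVal (potential S) Q p = 0 ∧
      radial (potential S) p * ((Q p).2 - zetaOf Q p * p.2) = 0 := by
  have hM := isOpen_dom hΩ.isOpen
  have sη : ContDiffOn ℝ ∞ (fun p => (Q p).2) (dom Ω) := contDiff_snd.comp_contDiffOn hQ
  have sξ : ∀ κ, ContDiffOn ℝ ∞ (fun p => (Q p).1 κ) (dom Ω) := fun κ =>
    contDiffOn_pi.1 (contDiff_fst.comp_contDiffOn hQ) κ
  have sζ : ContDiffOn ℝ ∞ (zetaOf Q) (dom Ω) := pd_smooth hM sη _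
  set η0 : Base n → ℂ := fun p => (Q p).2 - zetaOf Q p * p.2 with hη0
  have sη0 : ContDiffOn ℝ ∞ η0 (dom Ω) := sη.sub (sζ.mul snd_smooth)
  have vη0 : ∀ q ∈ dom Ω, ∀ c : ℂ, pd (vert c) η0 q = 0 := by
    intro q hq c
    rw [hη0, pd_sub (differentiableAt_of_smooth hM sη hq)
      (differentiableAt_of_smooth hM (sζ.mul snd_smooth) hq),
      pd_mul (differentiableAt_of_smooth hM sζ hq) (differentiableAt_of_smooth hM snd_smooth hq),
      pd_vert_snd, h.eta_vert q hq, h.zeta_vert q hq]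
    ring
  have vpd : ∀ {F : Type} [NormedAddCommGroup F] [NormedSpace ℝ F] {f : Base n → F},
      ContDiffOn ℝ ∞ f (dom Ω) → (∀ q ∈ dom Ω, ∀ c : ℂ, pd (vert c) f q = 0) → ∀ v,
      ∀ q ∈ dom Ω, ∀ c : ℂ, pd (vert c) (pd v f) q = 0 := fun hf hv v q hq c =>
    pd_pd_eq_zero hM hf (fun q hq => hv q hq c) v hq
  have h0 := snd_ne_zero_of_mem_dom hΩ hp
  have key : ∀ e : ℂ, ‖e‖ = 1 → classVal (potential S) Q p * (e * p.2)
      + (Complex.I * pd (ez 0) η0 p + ∑ b : Fin n, pd (ez b.succ) (pd (ez b.succ) η0) p)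
      + potential S p * η0 p
      + (η0 p / (e * p.2)).re * radial (potential S) p * (e * p.2) = 0 := by
    intro e he
    have hm := rotate_mem_dom hp he
    have h1 := h.rest _ hm
    rw [rest_eq hΩ hS hQ hm, ← hη0] at h1
    have r0 : ∀ {F : Type} [NormedAddCommGroup F] [NormedSpace ℝ F] {f : Base n → F},
        ContDiffOn ℝ ∞ f (dom Ω) → (∀ q ∈ dom Ω, ∀ c : ℂ, pd (vert c) f q = 0) →
        f (p.1, e * p.2) = f p := fun hf hv => eq_of_pd_vert_eq_zero hΩ.isOpen hf hv hp he
    have r1 : radial (potential S) (p.1, e * p.2) = radial (potential S) p :=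
      pd_potential_rotate hΩ hS hp he 0 p.2
    have r2 : ∀ μ, pd (ez μ) (potential S) (p.1, e * p.2) = pd (ez μ) (potential S) p := fun μ => by
      simpa using pd_potential_rotate hΩ hS hp he (Pi.single μ 1) 0
    have r3 : classVal (potential S) Q (p.1, e * p.2) = classVal (potential S) Q p := by
      have c1 : ∀ κ, (Q (p.1, e * p.2)).1 κ = (Q p).1 κ := fun κ =>
        r0 (sξ κ) (fun q hq c => h.xi_vert q hq κ c)
      simp only [classVal, r1, r2, c1, potential_rotate S p he, r0 sζ h.zeta_vert,
        r0 (pd_smooth hM sζ _) (vpd sζ h.zeta_vert _),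
        r0 (pd_smooth hM (pd_smooth hM sζ _) _)
          (vpd (pd_smooth hM sζ _) (vpd sζ h.zeta_vert _) _),
        r0 (pd_smooth hM (sξ 0) _) (vpd (sξ 0) (fun q hq c => h.xi_vert q hq 0 c) _)]
    have r4 := r0 sη0 vη0
    have r5 : ∀ v, pd v η0 (p.1, e * p.2) = pd v η0 p := fun v =>
      r0 (pd_smooth hM sη0 _) (vpd sη0 vη0 v)
    have r6 : ∀ v, pd v (pd v η0) (p.1, e * p.2) = pd v (pd v η0) p := fun v =>
      r0 (pd_smooth hM (pd_smooth hM sη0 _) _) (vpd (pd_smooth hM sη0 _) (vpd sη0 vη0 v) v)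
    simp only [r1, r3, r5, r6, potential_rotate S p he] at h1
    rw [← r4]
    exact h1
  have k1 := key 1 (by simp)
  have k2 := key (-1) (by simp)
  have k3 := key Complex.I (by simp)
  have q2 : η0 p / (-1 * p.2) = - (η0 p / p.2) := by field_simp
  have q3 : η0 p / (Complex.I * p.2) = -Complex.I * (η0 p / p.2) := by
    field_simp
    simp
  rw [one_mul] at k1
  rw [q2] at k2
  rw [q3] at k3
  have hc : classVal (potential S) Q p = 0 := by
    have : classVal (potential S) Q p * p.2 = 0 := by
      simp only [Complex.neg_re, Complex.ofReal_neg] at k2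
      linear_combination (k1 - k2) / 2
    exact (mul_eq_zero.1 this).resolve_right h0
  refine ⟨hc, ?_⟩
  have hre : (-Complex.I * (η0 p / p.2)).re = (η0 p / p.2).im := by simp
  rw [hre] at k3
  rw [hc] at k1 k3
  have hconj : radial (potential S) p * (starRingEnd ℂ (η0 p / p.2)) = 0 := by
    have : radial (potential S) p * (((η0 p / p.2).re : ℂ) - (η0 p / p.2).im * Complex.I) * p.2
        = 0 := by
      linear_combination k1 - k3
    have h2 : ∀ g : ℂ, starRingEnd ℂ g = (g.re : ℂ) - g.im * Complex.I := fun g => by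
      apply Complex.ext <;> simp
    rw [h2]
    exact (mul_eq_zero.1 this).resolve_right h0
  rcases mul_eq_zero.1 hconj with hr | hr
  · rw [hr, zero_mul]
  · have : η0 p / p.2 = 0 := by simpa using hr
    exact mul_eq_zero_of_right _ ((div_eq_zero_iff.1 this).resolve_right h0)

/-- Where η⁰ ≠ 0, the derivative S_ρ must vanish. By continuity this would hold on a nonempty open
set, which the assumption on S_ρ excludes. -/
lemma DetEqns.eta_eq (hΩ : IsDomainRho Ω) (hS : ContDiffOn ℝ ∞ S Ω)
    (hQ : ContDiffOn ℝ ∞ Q (dom Ω))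
    (hne : ∀ U : Set ((Fin (n + 1) → ℝ) × ℝ), IsOpen U → U ⊆ Ω → U.Nonempty →
    ∃ q ∈ U, derivRho S q ≠ 0) (h : DetEqns (dom Ω) (potential S) Q) {p : Base n}
    (hp : p ∈ dom Ω) : (Q p).2 = zetaOf Q p * p.2 := by
  have hM := isOpen_dom hΩ.isOpen
  have sη : ContDiffOn ℝ ∞ (fun p => (Q p).2) (dom Ω) := contDiff_snd.comp_contDiffOn hQ
  have sζ : ContDiffOn ℝ ∞ (zetaOf Q) (dom Ω) := pd_smooth hM sη _
  by_contra hcon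
  set η0 : Base n → ℂ := fun p => (Q p).2 - zetaOf Q p * p.2 with hη0
  have sη0 : ContDiffOn ℝ ∞ η0 (dom Ω) := sη.sub (sζ.mul snd_smooth)
  have hV : IsOpen (dom Ω ∩ η0 ⁻¹' {0}ᶜ) :=
    sη0.continuousOn.isOpen_inter_preimage hM isOpen_compl_singleton
  have h0 := snd_ne_zero_of_mem_dom hΩ hp
  have hn0 : (‖p.2‖ : ℂ) ≠ 0 := by simpa using h0
  -- A section of (z, ψ) ↦ (z, |ψ|) with the constant phase of `p`; it passes through `p` and pulls
  -- {η⁰ ≠ 0} back to an open subset of Ω.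
  let g : (Fin (n + 1) → ℝ) × ℝ → Base n := fun q => (q.1, (q.2 : ℂ) * (p.2 / ‖p.2‖))
  have hg : Continuous g := by
    dsimp only [g]
    fun_prop
  have hgn : ∀ q ∈ Ω, ‖(g q).2‖ = q.2 := by
    intro q hq
    have : ‖p.2‖ ≠ 0 := by simpa using h0
    simp [g, abs_of_pos (hΩ.rho_pos q hq), this]
  have hgd : ∀ q ∈ Ω, g q ∈ dom Ω := by
    intro q hq
    rw [dom, Set.mem_ofPred_eq, hgn q hq]
    exact hq
  obtain ⟨q, ⟨hqΩ, hqV⟩, hq⟩ := hne (Ω ∩ g ⁻¹' (dom Ω ∩ η0 ⁻¹' {0}ᶜ))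
    (hΩ.isOpen.inter (hV.preimage hg)) Set.inter_subset_left
    ⟨(p.1, ‖p.2‖), hp, by
      have : g (p.1, ‖p.2‖) = p := by
        refine Prod.ext rfl ?_
        simp only [g]
        field_simp
      rw [Set.mem_preimage, this]
      exact ⟨hp, fun h => hcon (sub_eq_zero.1 h)⟩⟩
  have h1 := (h.classVal_and_radial hΩ hS hQ (hgd q hqΩ)).2
  rw [radial_potential hΩ hS (hgd q hqΩ), hgn q hqΩ] at h1
  have h2 : ((q.2 : ℝ) : ℂ) ≠ 0 := by exact_mod_cast (hΩ.rho_pos q hqΩ).ne'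
  exact hqV.2 ((mul_eq_zero.1 h1).resolve_left (mul_ne_zero h2 hq))

lemma rest_of_classVal (hΩ : IsDomainRho Ω) (hS : ContDiffOn ℝ ∞ S Ω)
    (hQ : ContDiffOn ℝ ∞ Q (dom Ω))
    (hη : ∀ p ∈ dom Ω, (Q p).2 = zetaOf Q p * p.2) {p : Base n}
    (hp : p ∈ dom Ω) (hc : classVal (potential S) Q p = 0) :
    Complex.I * pd (ez 0) (fun p => (Q p).2) p
      + ∑ b : Fin n, pd (ez b.succ) (pd (ez b.succ) fun p => (Q p).2) p
      + (pd (ez 0) (fun p => (Q p).1 0) p - zetaOf Q p) * (potential S p * p.2)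
      + (pd (Q p) (potential S) p * p.2 + potential S p * (Q p).2) = 0 := by
  have hM := isOpen_dom hΩ.isOpen
  have z1 : ∀ q ∈ dom Ω, (Q q).2 - zetaOf Q q * q.2 = 0 := fun q hq => by rw [hη q hq, sub_self]
  have z2 : ∀ v, ∀ q ∈ dom Ω, pd v (fun p => (Q p).2 - zetaOf Q p * p.2) q = 0 := fun v q hq =>
    pd_eq_zero_of_const hM z1 v hq
  rw [rest_eq hΩ hS hQ hp, hc, z1 p hp, z2 _ p hp]
  simp [pd_eq_zero_of_const hM (z2 _) _ hp]

end Classifying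

/-! ### Uniqueness for closed linear differential systems. -/

section LinearSystem

variable {E ι : Type*} [NormedAddCommGroup E] [NormedSpace ℝ E] [Fintype ι] {M : Set E}
  {y : ι → E → ℝ} {f g : E → ℝ}

/-- On `M`, the function `f` is a linear combination of the functions `y i` with smooth
coefficients. -/
def InSpan (M : Set E) (y : ι → E → ℝ) (f : E → ℝ) : Prop :=
  ∃ c : ι → E → ℝ, (∀ i, ContDiffOn ℝ ∞ (c i) M) ∧ ∀ p ∈ M, f p = ∑ i, c i p * y i p

lemma InSpan.congr (hf : InSpan M y f) (h : ∀ p ∈ M, g p = f p) : InSpan M y g := by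
  obtain ⟨c, hc, hcf⟩ := hf
  exact ⟨c, hc, fun p hp => (h p hp).trans (hcf p hp)⟩

lemma InSpan.of_eq_zero (h : ∀ p ∈ M, f p = 0) : InSpan M y f :=
  ⟨fun _ _ => 0, fun _ => contDiffOn_const, fun p hp => by simp [h p hp]⟩

lemma InSpan.add (hf : InSpan M y f) (hg : InSpan M y g) : InSpan M y (fun p => f p + g p) := by
  obtain ⟨c, hc, hcf⟩ := hf
  obtain ⟨d, hd, hdg⟩ := hg
  exact ⟨fun i p => c i p + d i p, fun i => (hc i).add (hd i), fun p hp => by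
    simp only [hcf p hp, hdg p hp, add_mul, Finset.sum_add_distrib]⟩

lemma InSpan.mul_left (hf : InSpan M y f) (hg : ContDiffOn ℝ ∞ g M) :
    InSpan M y (fun p => g p * f p) := by
  obtain ⟨c, hc, hcf⟩ := hf
  exact ⟨fun i p => g p * c i p, fun i => hg.mul (hc i), fun p hp => by
    simp only [hcf p hp, Finset.mul_sum, mul_assoc]⟩

lemma InSpan.mul_right (hf : InSpan M y f) (hg : ContDiffOn ℝ ∞ g M) :
    InSpan M y (fun p => f p * g p) :=
  (hf.mul_left hg).congr fun _ _ => mul_comm _ _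

lemma InSpan.const_mul (hf : InSpan M y f) (a : ℝ) : InSpan M y (fun p => a * f p) :=
  hf.mul_left contDiffOn_const

lemma InSpan.sum {κ : Type*} (s : Finset κ) {f : κ → E → ℝ} (hf : ∀ k ∈ s, InSpan M y (f k)) :
    InSpan M y (fun p => ∑ k ∈ s, f k p) := by
  classical
  induction s using Finset.induction_on with
  | empty => exact InSpan.of_eq_zero (by simp)
  | insert a s ha ih =>
    refine ((hf a (by simp)).add (ih fun k hk => hf k (by simp [hk]))).congr fun p _ => ?_
    rw [Finset.sum_insert ha]

lemma InSpan.gen (i : ι) : InSpan M y (y i) := by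
  classical
  exact ⟨fun j _ => if j = i then 1 else 0, fun _ => contDiffOn_const, fun p _ => by simp⟩

/-- By the Leibniz rule the span is stable under a derivative as soon as the derivatives of the
generators lie in it. -/
lemma InSpan.pd (hM : IsOpen M) (hy : ∀ i, ContDiffOn ℝ ∞ (y i) M) {v : E}
    (hv : ∀ i, InSpan M y (pd v (y i))) (hf : InSpan M y f) : InSpan M y (pd v f) := by
  obtain ⟨c, hc, hcf⟩ := hf
  have h1 : InSpan M y (fun p => ∑ i, (NLS.pd v (c i) p * y i p + c i p * NLS.pd v (y i) p)) :=
    InSpan.sum _ fun i _ =>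
      ((InSpan.gen i).mul_left (pd_smooth hM (hc i) v)).add ((hv i).mul_left (hc i))
  refine h1.congr fun p hp => ?_
  rw [pd_congr hM hcf v hp, pd_sum fun i _ => differentiableAt_of_smooth hM ((hc i).mul (hy i)) hp]
  exact Finset.sum_congr rfl fun i _ => pd_mul (differentiableAt_of_smooth hM (hc i) hp)
    (differentiableAt_of_smooth hM (hy i) hp) v

/-- A solution of a linear differential system along a segment vanishes if it vanishes at the
beginning of the segment. -/
lemma eq_zero_of_segment (hM : IsOpen M) (hy : ∀ i, ContDiffOn ℝ ∞ (y i) M) {p v : E}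
    (hv : ∀ i, InSpan M y (pd v (y i))) (hseg : ∀ t ∈ Set.Icc (0 : ℝ) 1, p + t • v ∈ M)
    (h0 : ∀ i, y i p = 0) (i : ι) : y i (p + v) = 0 := by
  choose c hc hcy using hv
  -- The sum of all |c i j| bounds the coefficient matrix in the sup norm; its maximum on the
  -- compact segment is the Grönwall constant.
  have hcont : ContinuousOn (fun t : ℝ => ∑ i, ∑ j, |c i j (p + t • v)|) (Set.Icc 0 1) := by
    refine continuousOn_finsetSum _ fun i _ => continuousOn_finsetSum _ fun j _ => ?_
    refine ContinuousOn.abs ((hc i j).continuousOn.comp (by fun_prop) hseg)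
  obtain ⟨K, hK⟩ := isCompact_Icc.exists_bound_of_continuousOn hcont
  have hd : ∀ t ∈ Set.Icc (0 : ℝ) 1, HasDerivAt (fun t : ℝ => fun i => y i (p + t • v))
      (fun i => pd v (y i) (p + t • v)) t := by
    intro t ht
    refine hasDerivAt_pi.2 fun i => ?_
    have h1 : HasDerivAt (fun t : ℝ => p + t • v) v t := by
      simpa using ((hasDerivAt_id t).smul_const v).const_add p
    exact (differentiableAt_of_smooth hM (hy i) (hseg t ht)).hasFDerivAt.comp_hasDerivAt t h1
  have key := norm_le_gronwallBound_of_norm_deriv_right_le (δ := 0) (K := K) (ε := 0)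
    (f := fun t : ℝ => fun i => y i (p + t • v)) (f' := fun t => fun i => pd v (y i) (p + t • v))
    (a := 0) (b := 1) (fun t ht => (hd t ht).continuousAt.continuousWithinAt)
    (fun t ht => (hd t (Set.Ico_subset_Icc_self ht)).hasDerivWithinAt)
    (by
      rw [norm_le_zero_iff]
      funext i
      simp [h0])
    (fun t ht => by
      have ht' := Set.Ico_subset_Icc_self ht
      have hK' := hK t ht'
      rw [Real.norm_of_nonneg (by positivity)] at hK'
      rw [add_zero, pi_norm_le_iff_of_nonneg (mul_nonneg (le_trans (by positivity) hK')
        (norm_nonneg _))]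
      intro i
      rw [hcy i _ (hseg t ht')]
      calc ‖∑ j, c i j (p + t • v) * y j (p + t • v)‖
          ≤ ∑ j, |c i j (p + t • v)| * ‖fun j => y j (p + t • v)‖ := by
            refine (norm_sum_le _ _).trans (Finset.sum_le_sum fun j _ => ?_)
            rw [norm_mul, Real.norm_eq_abs]
            gcongr
            exact norm_le_pi_norm (fun j => y j (p + t • v)) j
        _ ≤ K * ‖fun j => y j (p + t • v)‖ := by
            rw [← Finset.sum_mul]
            gcongr
            refine le_trans ?_ hK'
            exact Finset.single_le_sum (f := fun i => ∑ j, |c i j (p + t • v)|)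
              (fun i _ => by positivity) (Finset.mem_univ i))
    1 (by simp)
  rw [gronwallBound_ε0_δ0, norm_le_zero_iff] at key
  simpa using congrFun key i

/-- The common zero set is relatively closed, and it is open because segments inside a ball carry
the vanishing from the centre to every point of the ball. Connectedness does the rest. -/
lemma eq_zero_of_linear_system (hM : IsOpen M) (hc : IsPreconnected M)
    (hy : ∀ i, ContDiffOn ℝ ∞ (y i) M) (hv : ∀ i v, InSpan M y (pd v (y i))) {p₀ : E}
    (hp₀ : p₀ ∈ M) (h0 : ∀ i, y i p₀ = 0) : ∀ p ∈ M, ∀ i, y i p = 0 := by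
  have hcont : ContinuousOn (fun p i => y i p) M := continuousOn_pi.2 fun i => (hy i).continuousOn
  have ho1 : IsOpen (M ∩ (fun p i => y i p) ⁻¹' {0}ᶜ) :=
    hcont.isOpen_inter_preimage hM isOpen_compl_singleton
  have ho2 : IsOpen {p | p ∈ M ∧ ∀ i, y i p = 0} := by
    rw [Metric.isOpen_iff]
    rintro p ⟨hp, hp0⟩
    obtain ⟨ε, hε, hb⟩ := Metric.isOpen_iff.1 hM p hp
    refine ⟨ε, hε, fun q hq => ⟨hb hq, fun i => ?_⟩⟩
    have := eq_zero_of_segment hM hy (p := p) (v := q - p) (fun i => hv i _) (fun t ht => hb ?_)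
      hp0 i
    · simpa using this
    · have := (convex_ball p ε).add_smul_sub_mem (Metric.mem_ball_self hε) hq ht
      exact this
  intro p hp i
  by_contra hne
  obtain ⟨q, hq, ⟨_, hq1⟩, ⟨_, hq2⟩⟩ := hc _ _ ho2 ho1
    (fun q hq => by
      by_cases h : ∀ i, y i q = 0
      · exact Or.inl ⟨hq, h⟩
      · exact Or.inr ⟨hq, fun h' => h fun i => congrFun h' i⟩)
    ⟨p₀, hp₀, hp₀, h0⟩ ⟨p, hp, hp, fun h' => hne (congrFun h' i)⟩
  exact hq2 (funext hq1)

end LinearSystem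

/-! ### The real system for τ, ξ and ζ = α + iβ, and its closure. -/

section ReducedSystem

variable {n : ℕ} {M : Set (Base n)}

/-- Since τ_t does not depend on x, ∂_c∂_b X^a is antisymmetric in a, b, and it is symmetric in b,
c. Applying the two symmetries alternately returns the expression with the opposite sign. -/
lemma pd_pd_eq_zero_of_killing (hM : IsOpen M) {τ : Base n → ℝ} {X : Fin n → Base n → ℝ}
    (hτ : ContDiffOn ℝ ∞ τ M) (hX : ∀ a, ContDiffOn ℝ ∞ (X a) M)
    (tau_space : ∀ p ∈ M, ∀ a : Fin n, pd (ez a.succ) τ p = 0)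
    (killing : ∀ p ∈ M, ∀ a b : Fin n, pd (ez a.succ) (X b) p + pd (ez b.succ) (X a) p
      = if a = b then pd (ez 0) τ p else 0) {p : Base n} (hp : p ∈ M) (a b c : Fin n) :
    pd (ez c.succ) (pd (ez b.succ) (X a)) p = 0 := by
  have hs : ∀ a b c : Fin n, pd (ez c.succ) (pd (ez b.succ) (X a)) p
      = pd (ez b.succ) (pd (ez c.succ) (X a)) p := fun a b c => pd_comm hM (hX a) _ _ hp
  have hk : ∀ a b c : Fin n, pd (ez c.succ) (pd (ez b.succ) (X a)) p
      = - pd (ez c.succ) (pd (ez a.succ) (X b)) p := by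
    intro a b c
    have h1 := pd_congr hM (fun q hq => killing q hq a b) (ez c.succ) hp
    rw [pd_add (differentiableAt_of_smooth hM (pd_smooth hM (hX b) _) hp)
      (differentiableAt_of_smooth hM (pd_smooth hM (hX a) _) hp)] at h1
    have h2 : pd (ez c.succ) (fun q => if a = b then pd (ez 0) τ q else 0) p = 0 := by
      split_ifs
      · exact pd_pd_eq_zero hM hτ (fun q hq => tau_space q hq c) _ hp
      · exact pd_const _ _ _
    linarith
  have e1 := hk a b c
  have e2 := hs b a c
  have e3 := hk b c a
  have e4 := hs c b a
  have e5 := hk c a b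
  have e6 := hs a c b
  linarith

/-- The left-hand side of the classifying equation without the terms with `ζ_t` and `ζ_{aa}`, for
a real component `g` of the potential and the component `r` of `ρ S_ρ`. -/
def classForm (τ α : Base n → ℝ) (X : Fin n → Base n → ℝ) (g r : Base n → ℝ) (p : Base n) : ℝ :=
  pd (ez 0) τ p * g p + τ p * pd (ez 0) g p + ∑ a, X a p * pd (ez a.succ) g p + α p * r p

/-- The system for the coefficients of the vector field
`τ ∂_t + X^a ∂_a + (α + i β)ψ ∂_ψ + (α - i β)ψ* ∂_{ψ*}`; the functions `g + i g'` and `r + i r'`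
represent `S` and `ρ S_ρ`. -/
structure ReducedSystem (M : Set (Base n)) (τ α β : Base n → ℝ) (X : Fin n → Base n → ℝ)
    (g r g' r' : Base n → ℝ) : Prop where
  tau_smooth : ContDiffOn ℝ ∞ τ M
  alpha_smooth : ContDiffOn ℝ ∞ α M
  beta_smooth : ContDiffOn ℝ ∞ β M
  xi_smooth : ∀ a, ContDiffOn ℝ ∞ (X a) M
  g_smooth : ContDiffOn ℝ ∞ g M
  r_smooth : ContDiffOn ℝ ∞ r M
  g_smooth' : ContDiffOn ℝ ∞ g' M
  r_smooth' : ContDiffOn ℝ ∞ r' M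
  tau_vert : ∀ p ∈ M, ∀ c : ℂ, pd (vert c) τ p = 0
  alpha_vert : ∀ p ∈ M, ∀ c : ℂ, pd (vert c) α p = 0
  beta_vert : ∀ p ∈ M, ∀ c : ℂ, pd (vert c) β p = 0
  xi_vert : ∀ a, ∀ p ∈ M, ∀ c : ℂ, pd (vert c) (X a) p = 0
  tau_space : ∀ p ∈ M, ∀ a : Fin n, pd (ez a.succ) τ p = 0
  killing : ∀ p ∈ M, ∀ a b : Fin n, pd (ez a.succ) (X b) p + pd (ez b.succ) (X a) p
    = if a = b then pd (ez 0) τ p else 0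
  alpha_space : ∀ p ∈ M, ∀ a : Fin n, pd (ez a.succ) α p = 0
  beta_space : ∀ p ∈ M, ∀ a : Fin n, pd (ez a.succ) β p = 1 / 2 * pd (ez 0) (X a) p
  alpha_time : ∀ p ∈ M, pd (ez 0) α p
    = -(n / 4) * pd (ez 0) (pd (ez 0) τ) p + -1 * classForm τ α X g' r' p
  beta_time : ∀ p ∈ M, pd (ez 0) β p = classForm τ α X g r p

/-- The functions for which the reduced system becomes a closed linear system. -/
def jetFamily (τ α β : Base n → ℝ) (X : Fin n → Base n → ℝ) :
    Fin 5 ⊕ Fin n ⊕ Fin n ⊕ Fin n × Fin n → Base n → ℝ :=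
  Sum.elim ![τ, pd (ez 0) τ, pd (ez 0) (pd (ez 0) τ), α, β]
    (Sum.elim X (Sum.elim (fun a => pd (ez 0) (X a)) fun ab => pd (ez ab.2.succ) (X ab.1)))

/-- ∂_b∂_t X^a = 2∂_b∂_aβ is symmetric in a and b, and the time derivative of the Killing relation
prescribes the symmetric part. -/
lemma xi_time_space (hM : IsOpen M) {τ β : Base n → ℝ} {X : Fin n → Base n → ℝ}
    (hβ : ContDiffOn ℝ ∞ β M) (hX : ∀ a, ContDiffOn ℝ ∞ (X a) M)
    (killing : ∀ p ∈ M, ∀ a b : Fin n, pd (ez a.succ) (X b) p + pd (ez b.succ) (X a) p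
      = if a = b then pd (ez 0) τ p else 0)
    (beta_space : ∀ p ∈ M, ∀ a : Fin n, pd (ez a.succ) β p = 1 / 2 * pd (ez 0) (X a) p)
    {p : Base n} (hp : p ∈ M) (a b : Fin n) :
    pd (ez b.succ) (pd (ez 0) (X a)) p
      = if a = b then 1 / 2 * pd (ez 0) (pd (ez 0) τ) p else 0 := by
  have hb : ∀ a b : Fin n, pd (ez b.succ) (pd (ez a.succ) β) p
      = 1 / 2 * pd (ez b.succ) (pd (ez 0) (X a)) p := fun a b => by
    rw [pd_congr hM (fun q hq => beta_space q hq a) _ hp,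
      pd_const_mul (differentiableAt_of_smooth hM (pd_smooth hM (hX a) _) hp)]
  have h1 := hb a b
  have h2 := hb b a
  rw [pd_comm hM hβ _ _ hp] at h1
  have h3 := pd_congr hM (fun q hq => killing q hq a b) (ez 0) hp
  rw [pd_add (differentiableAt_of_smooth hM (pd_smooth hM (hX b) _) hp)
      (differentiableAt_of_smooth hM (pd_smooth hM (hX a) _) hp),
    pd_comm hM (hX a) _ _ hp, pd_comm hM (hX b) _ _ hp] at h3
  have h4 : pd (ez 0) (fun q => if a = b then pd (ez 0) τ q else 0) p
      = if a = b then pd (ez 0) (pd (ez 0) τ) p else 0 := by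
    split_ifs
    · rfl
    · exact pd_const _ _ _
  rw [h4] at h3
  split_ifs with hab
  · rw [if_pos hab] at h3
    linarith
  · rw [if_neg hab] at h3
    linarith

namespace ReducedSystem

variable {τ α β : Base n → ℝ} {X : Fin n → Base n → ℝ} {g r g' r' : Base n → ℝ}

lemma inSpan_tau : InSpan M (jetFamily τ α β X) τ :=
  InSpan.gen (y := jetFamily τ α β X) (.inl 0)

lemma inSpan_tau_time : InSpan M (jetFamily τ α β X) (pd (ez 0) τ) :=
  InSpan.gen (y := jetFamily τ α β X) (.inl 1)

lemma inSpan_tau_time_time : InSpan M (jetFamily τ α β X) (pd (ez 0) (pd (ez 0) τ)) :=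
  InSpan.gen (y := jetFamily τ α β X) (.inl 2)

lemma inSpan_alpha : InSpan M (jetFamily τ α β X) α :=
  InSpan.gen (y := jetFamily τ α β X) (.inl 3)

lemma inSpan_xi (a : Fin n) : InSpan M (jetFamily τ α β X) (X a) :=
  InSpan.gen (y := jetFamily τ α β X) (.inr (.inl a))

lemma inSpan_xi_time (a : Fin n) : InSpan M (jetFamily τ α β X) (pd (ez 0) (X a)) :=
  InSpan.gen (y := jetFamily τ α β X) (.inr (.inr (.inl a)))

lemma inSpan_xi_space (a b : Fin n) : InSpan M (jetFamily τ α β X) (pd (ez b.succ) (X a)) :=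
  InSpan.gen (y := jetFamily τ α β X) (.inr (.inr (.inr (a, b))))

lemma jetFamily_smooth (hM : IsOpen M) (h : ReducedSystem M τ α β X g r g' r')
    (i : Fin 5 ⊕ Fin n ⊕ Fin n ⊕ Fin n × Fin n) : ContDiffOn ℝ ∞ (jetFamily τ α β X i) M := by
  rcases i with i | a | a | ab
  · fin_cases i
    · exact h.tau_smooth
    · exact pd_smooth hM h.tau_smooth _
    · exact pd_smooth hM (pd_smooth hM h.tau_smooth _) _
    · exact h.alpha_smooth
    · exact h.beta_smooth
  · exact h.xi_smooth a
  · exact pd_smooth hM (h.xi_smooth a) _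
  · exact pd_smooth hM (h.xi_smooth ab.1) _

lemma jetFamily_vert (hM : IsOpen M) (h : ReducedSystem M τ α β X g r g' r')
    (i : Fin 5 ⊕ Fin n ⊕ Fin n ⊕ Fin n × Fin n) (c : ℂ) {p : Base n} (hp : p ∈ M) :
    pd (vert c) (jetFamily τ α β X i) p = 0 := by
  have ht := fun q hq => h.tau_vert q hq c
  have hx := fun a q hq => h.xi_vert a q hq c
  rcases i with i | a | a | ab
  · fin_cases i
    · exact ht p hp
    · exact pd_pd_eq_zero hM h.tau_smooth ht _ hp
    · exact pd_pd_eq_zero hM (pd_smooth hM h.tau_smooth _)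
        (fun q hq => pd_pd_eq_zero hM h.tau_smooth ht _ hq) _ hp
    · exact h.alpha_vert p hp c
    · exact h.beta_vert p hp c
  · exact hx a p hp
  · exact pd_pd_eq_zero hM (h.xi_smooth a) (hx a) _ hp
  · exact pd_pd_eq_zero hM (h.xi_smooth ab.1) (hx ab.1) _ hp

lemma jetFamily_space (hM : IsOpen M) (h : ReducedSystem M τ α β X g r g' r')
    (i : Fin 5 ⊕ Fin n ⊕ Fin n ⊕ Fin n × Fin n) (b : Fin n) :
    InSpan M (jetFamily τ α β X) (pd (ez b.succ) (jetFamily τ α β X i)) := by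
  have ht := fun q hq => h.tau_space q hq b
  rcases i with i | a | a | ab
  · fin_cases i
    · exact InSpan.of_eq_zero ht
    · exact InSpan.of_eq_zero fun p hp => pd_pd_eq_zero hM h.tau_smooth ht _ hp
    · exact InSpan.of_eq_zero fun p hp => pd_pd_eq_zero hM (pd_smooth hM h.tau_smooth _)
        (fun q hq => pd_pd_eq_zero hM h.tau_smooth ht _ hq) _ hp
    · exact InSpan.of_eq_zero fun p hp => h.alpha_space p hp b
    · exact ((inSpan_xi_time b).const_mul (1 / 2)).congr
        fun p hp => h.beta_space p hp b
  · exact inSpan_xi_space a b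
  · by_cases hab : a = b
    · exact (inSpan_tau_time_time.const_mul (1 / 2)).congr fun p hp =>
        (xi_time_space hM h.beta_smooth h.xi_smooth h.killing h.beta_space hp a b).trans
          (if_pos hab)
    · exact InSpan.of_eq_zero fun p hp =>
        (xi_time_space hM h.beta_smooth h.xi_smooth h.killing h.beta_space hp a b).trans
          (if_neg hab)
  · exact InSpan.of_eq_zero fun p hp => pd_pd_eq_zero_of_killing hM h.tau_smooth h.xi_smooth
      h.tau_space h.killing hp ab.1 ab.2 b

lemma classForm_inSpan (hM : IsOpen M) {g r : Base n → ℝ}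
    (hg : ContDiffOn ℝ ∞ g M) (hr : ContDiffOn ℝ ∞ r M) :
    InSpan M (jetFamily τ α β X) (classForm τ α X g r) :=
  (((inSpan_tau_time.mul_right hg).add
    (inSpan_tau.mul_right (pd_smooth hM hg _))).add
    (InSpan.sum _ fun a _ => (inSpan_xi a).mul_right (pd_smooth hM hg _))).add
    (inSpan_alpha.mul_right hr)

/-- X^a_t = 2∂_aβ, and β_t is given by the classifying equation; so X^a_tt is an x-derivative of an
expression of lower order. -/
lemma xi_time_time (hM : IsOpen M) (h : ReducedSystem M τ α β X g r g' r') {p : Base n}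
    (hp : p ∈ M) (a : Fin n) :
    pd (ez 0) (pd (ez 0) (X a)) p = 2 * pd (ez a.succ) (classForm τ α X g r) p := by
  have h1 : ∀ q ∈ M, pd (ez 0) (X a) q = 2 * pd (ez a.succ) β q := fun q hq => by
    rw [h.beta_space q hq]; ring
  rw [pd_congr hM h1 _ hp,
    pd_const_mul (differentiableAt_of_smooth hM (pd_smooth hM h.beta_smooth _) hp),
    pd_comm hM h.beta_smooth _ _ hp, pd_congr hM h.beta_time _ hp]

/-- The system closes because `classForm` lies in the span and the span is stable under
x-derivatives. This puts X^a_tt in the span, and τ_tt = 2∂_aX^a_t, valid for any one index a, then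
gives τ_ttt = 2∂_aX^a_tt. The latter is where n ≥ 1 enters. -/
lemma jetFamily_time (hn : 1 ≤ n) (hM : IsOpen M) (h : ReducedSystem M τ α β X g r g' r')
    (i : Fin 5 ⊕ Fin n ⊕ Fin n ⊕ Fin n × Fin n) :
    InSpan M (jetFamily τ α β X) (pd (ez 0) (jetFamily τ α β X i)) := by
  have hsp : ∀ (b : Fin n) {f : Base n → ℝ}, InSpan M (jetFamily τ α β X) f →
      InSpan M (jetFamily τ α β X) (pd (ez b.succ) f) := fun b _ hf =>
    hf.pd hM (h.jetFamily_smooth hM) (fun i => h.jetFamily_space hM i b)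
  have hW : InSpan M (jetFamily τ α β X) (classForm τ α X g r) :=
    classForm_inSpan hM h.g_smooth h.r_smooth
  have hxtt : ∀ a, InSpan M (jetFamily τ α β X) (pd (ez 0) (pd (ez 0) (X a))) := fun a =>
    ((hsp a hW).const_mul 2).congr fun p hp => h.xi_time_time hM hp a
  rcases i with i | a | a | ab
  · fin_cases i
    · exact inSpan_tau_time
    · exact inSpan_tau_time_time
    · have a : Fin n := ⟨0, hn⟩
      refine ((hsp a (hxtt a)).const_mul 2).congr fun p hp => ?_
      have h1 : ∀ q ∈ M, pd (ez 0) (pd (ez 0) τ) q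
          = 2 * pd (ez a.succ) (pd (ez 0) (X a)) q := fun q hq => by
        rw [xi_time_space hM h.beta_smooth h.xi_smooth h.killing h.beta_space hq, if_pos rfl]
        ring
      have sx := pd_smooth hM (h.xi_smooth a) (ez 0)
      have := pd_congr hM h1 (ez 0) hp
      rwa [pd_const_mul (differentiableAt_of_smooth hM (pd_smooth hM sx _) hp),
        pd_comm hM sx _ _ hp] at this
    · exact ((inSpan_tau_time_time.const_mul _).add
        ((classForm_inSpan hM h.g_smooth' h.r_smooth').const_mul _)).congr h.alpha_time
    · exact hW.congr h.beta_time
  · exact inSpan_xi_time a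
  · exact hxtt a
  · exact (h.jetFamily_space hM (.inr (.inr (.inl ab.1))) ab.2).congr fun p hp =>
      pd_comm hM (h.xi_smooth ab.1) _ _ hp

lemma eq_zero (hn : 1 ≤ n) (hM : IsOpen M) (hc : IsPreconnected M)
    (h : ReducedSystem M τ α β X g r g' r') {p₀ : Base n} (hp₀ : p₀ ∈ M)
    (h0 : ∀ i, jetFamily τ α β X i p₀ = 0) : ∀ p ∈ M, ∀ i, jetFamily τ α β X i p = 0 := by
  refine eq_zero_of_linear_system hM hc (h.jetFamily_smooth hM) (fun i v => ?_) hp₀ h0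
  have hz : ∀ μ, InSpan M (jetFamily τ α β X) (pd (ez μ) (jetFamily τ α β X i)) := fun μ =>
    Fin.cases (h.jetFamily_time hn hM i) (fun b => h.jetFamily_space hM i b) μ
  refine (InSpan.sum Finset.univ fun μ _ => (hz μ).const_mul (v.1 μ)).congr fun p hp => ?_
  rw [pd_eq_sum, h.jetFamily_vert hM i _ hp]
  simp

/-- The coefficients do not depend on ψ, so the derivative falls on g, r and the derivatives of g.
Every resulting term except the one with τ_t carries a factor that vanishes at p. -/
lemma pd_vert_classForm (hM : IsOpen M) (h : ReducedSystem M τ α β X g r g' r')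
    {g r : Base n → ℝ} (hg : ContDiffOn ℝ ∞ g M) (hr : ContDiffOn ℝ ∞ r M) (c : ℂ)
    {p : Base n} (hp : p ∈ M) (hτ : τ p = 0) (hX : ∀ a, X a p = 0) (hα : α p = 0) :
    pd (vert c) (classForm τ α X g r) p = pd (ez 0) τ p * pd (vert c) g p := by
  have dm : ∀ {f k : Base n → ℝ}, ContDiffOn ℝ ∞ f M → ContDiffOn ℝ ∞ k M → pd (vert c) f p = 0 →
      pd (vert c) (fun q => f q * k q) p = f p * pd (vert c) k p := fun hf hk h0 => by
    rw [pd_mul (differentiableAt_of_smooth hM hf hp) (differentiableAt_of_smooth hM hk hp), h0]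
    ring
  have s0 := h.tau_smooth
  have s1 := pd_smooth hM h.tau_smooth (ez 0)
  have k := fun v => pd_smooth hM hg v
  have m := fun a => (h.xi_smooth a).mul (k (ez a.succ))
  have D : ∀ {f : Base n → ℝ}, ContDiffOn ℝ ∞ f M → DifferentiableAt ℝ f p := fun hf =>
    differentiableAt_of_smooth hM hf hp
  have hs : ContDiffOn ℝ ∞ (fun q => ∑ a, X a q * pd (ez a.succ) g q) M :=
    ContDiffOn.sum fun a _ => m a
  unfold classForm
  rw [pd_add (D (((s1.mul hg).add (s0.mul (k _))).add hs)) (D (h.alpha_smooth.mul hr)),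
    pd_add (D ((s1.mul hg).add (s0.mul (k _)))) (D hs),
    pd_add (D (s1.mul hg)) (D (s0.mul (k _))), pd_sum fun a _ => D (m a),
    dm s1 hg (pd_pd_eq_zero hM s0 (fun q hq => h.tau_vert q hq c) _ hp),
    dm s0 (k _) (h.tau_vert p hp c), dm h.alpha_smooth hr (h.alpha_vert p hp c),
    Finset.sum_congr rfl fun a _ => dm (h.xi_smooth a) (k _) (h.xi_vert a p hp c)]
  simp [hτ, hX, hα]

/-- The coefficient `τ_t` vanishes at a point with `S_ρ ≠ 0` at which `τ`, `ξ` and `Re ζ` vanish. -/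
lemma tau_time_eq_zero (hM : IsOpen M) (h : ReducedSystem M τ α β X g r g' r') (c : ℂ)
    {p : Base n} (hp : p ∈ M) (hτ : τ p = 0) (hX : ∀ a, X a p = 0) (hα : α p = 0)
    (hg : pd (vert c) g p ≠ 0 ∨ pd (vert c) g' p ≠ 0) : pd (ez 0) τ p = 0 := by
  have e1 := h.pd_vert_classForm hM h.g_smooth h.r_smooth c hp hτ hX hα
  have e2 := h.pd_vert_classForm hM h.g_smooth' h.r_smooth' c hp hτ hX hα
  -- The classifying equation expresses both forms through α_t, β_t and τ_tt, none of which depends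
  -- on ψ.
  have b1 : pd (vert c) (classForm τ α X g r) p = 0 := by
    rw [← pd_congr hM h.beta_time _ hp]
    exact pd_pd_eq_zero hM h.beta_smooth (fun q hq => h.beta_vert q hq c) _ hp
  have b2 : pd (vert c) (classForm τ α X g' r') p = 0 := by
    have w : ∀ q ∈ M, classForm τ α X g' r' q
        = -(n / 4) * pd (ez 0) (pd (ez 0) τ) q - pd (ez 0) α q := fun q hq => by
      rw [h.alpha_time q hq]; ring
    have s1 := pd_smooth hM h.tau_smooth (ez 0)
    have s2 := pd_smooth hM s1 (ez 0)
    rw [pd_congr hM w _ hp, pd_sub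
      (differentiableAt_of_smooth hM (contDiffOn_const.mul s2) hp)
      (differentiableAt_of_smooth hM (pd_smooth hM h.alpha_smooth _) hp),
      pd_const_mul (differentiableAt_of_smooth hM s2 hp),
      pd_pd_eq_zero hM h.alpha_smooth (fun q hq => h.alpha_vert q hq c) _ hp,
      pd_pd_eq_zero hM s1 (fun q hq => pd_pd_eq_zero hM h.tau_smooth
        (fun q hq => h.tau_vert q hq c) _ hq) _ hp]
    simp
  rw [b1] at e1
  rw [b2] at e2
  rcases hg with hg | hg
  · exact (mul_eq_zero.1 e1.symm).resolve_right hg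
  · exact (mul_eq_zero.1 e2.symm).resolve_right hg

end ReducedSystem

end ReducedSystem

/-! ### The upper bound. -/

section UpperBound

variable {n : ℕ} {Ω : Set ((Fin (n + 1) → ℝ) × ℝ)} {S : (Fin (n + 1) → ℝ) × ℝ → ℂ}
  {Q : Base n → Base n}

lemma radial_smooth {M : Set (Base n)} (hM : IsOpen M) {s : Base n → ℂ}
    (hs : ContDiffOn ℝ ∞ s M) : ContDiffOn ℝ ∞ (radial s) M :=
  (hs.fderiv_of_isOpen (m := ∞) hM (by simp)).clm_apply
    (contDiffOn_const.prodMk contDiff_snd.contDiffOn)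

/-- Polar coordinates present `dom Ω` as a continuous image of Ω × ℝ. -/
lemma isPreconnected_dom (hΩ : IsDomainRho Ω) : IsPreconnected (dom Ω) := by
  have h1 : IsPreconnected (Ω ×ˢ (Set.univ : Set ℝ)) :=
    hΩ.isConnected.isPreconnected.prod isPreconnected_univ
  have h2 : dom Ω = (fun q : ((Fin (n + 1) → ℝ) × ℝ) × ℝ =>
      ((q.1.1, q.1.2 * Complex.exp (q.2 * Complex.I)) : Base n)) '' (Ω ×ˢ Set.univ) := by
    ext p
    constructor
    · intro hp
      exact ⟨((p.1, ‖p.2‖), p.2.arg), ⟨hp, trivial⟩,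
        Prod.ext rfl (Complex.norm_mul_exp_arg_mul_I p.2)⟩
    · rintro ⟨q, ⟨hq, -⟩, rfl⟩
      have : ‖(q.1.2 : ℂ) * Complex.exp (q.2 * Complex.I)‖ = q.1.2 := by
        simp [Complex.norm_exp_ofReal_mul_I, abs_of_pos (hΩ.rho_pos _ hq)]
      simp only [dom, Set.mem_ofPred_eq, this]
      exact hq
  rw [h2]
  exact h1.image _ (by fun_prop)

/-- The second x-derivatives of ξ vanish, so 2ζ_a = iξ^a_t. Hence Re ζ has zero x-derivatives and
ζ_{bb} = (i/4)τ_tt for each b. The real part of the classifying equation then gives β_t, the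
imaginary part α_t. -/
lemma DetEqns.reducedSystem (hΩ : IsDomainRho Ω) (hS : IsClassS Ω S)
    (hQ : ContDiffOn ℝ ∞ Q (dom Ω)) (h : DetEqns (dom Ω) (potential S) Q) :
    ReducedSystem (dom Ω) (fun p => (Q p).1 0) (fun p => (zetaOf Q p).re)
      (fun p => (zetaOf Q p).im) (fun a p => (Q p).1 a.succ)
      (fun p => (potential S p).re) (fun p => (radial (potential S) p).re)
      (fun p => (potential S p).im) (fun p => (radial (potential S) p).im) := by
  have hM := isOpen_dom hΩ.isOpen
  have sξ : ∀ κ, ContDiffOn ℝ ∞ (fun p => (Q p).1 κ) (dom Ω) := fun κ =>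
    contDiffOn_pi.1 (contDiff_fst.comp_contDiffOn hQ) κ
  have sζ : ContDiffOn ℝ ∞ (zetaOf Q) (dom Ω) :=
    pd_smooth hM (contDiff_snd.comp_contDiffOn hQ) _
  have ss := potential_smooth hΩ hS.smooth
  have sr := radial_smooth hM ss
  have re_s : ∀ {f : Base n → ℂ}, ContDiffOn ℝ ∞ f (dom Ω) →
      ContDiffOn ℝ ∞ (fun p => (f p).re) (dom Ω) := fun hf =>
    Complex.reCLM.contDiff.comp_contDiffOn hf
  have im_s : ∀ {f : Base n → ℂ}, ContDiffOn ℝ ∞ f (dom Ω) →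
      ContDiffOn ℝ ∞ (fun p => (f p).im) (dom Ω) := fun hf =>
    Complex.imCLM.contDiff.comp_contDiffOn hf
  have re_pd : ∀ {f : Base n → ℂ}, ContDiffOn ℝ ∞ f (dom Ω) → ∀ v, ∀ p ∈ dom Ω,
      pd v (fun p => (f p).re) p = (pd v f p).re := fun hf v p hp =>
    pd_re (differentiableAt_of_smooth hM hf hp) v
  have im_pd : ∀ {f : Base n → ℂ}, ContDiffOn ℝ ∞ f (dom Ω) → ∀ v, ∀ p ∈ dom Ω,
      pd v (fun p => (f p).im) p = (pd v f p).im := fun hf v p hp =>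
    pd_im (differentiableAt_of_smooth hM hf hp) v
  have hz : ∀ p ∈ dom Ω, ∀ a : Fin n, 2 * pd (ez a.succ) (zetaOf Q) p
      = Complex.I * pd (ez 0) (fun p => (Q p).1 a.succ) p := by
    intro p hp a
    rw [h.zeta_space p hp a, Finset.sum_eq_zero fun b _ =>
      pd_pd_eq_zero_of_killing hM (sξ 0) (fun a => sξ a.succ) h.tau_space h.killing hp a b b]
    simp
  have hα : ∀ p ∈ dom Ω, ∀ a : Fin n, pd (ez a.succ) (fun p => (zetaOf Q p).re) p = 0 := by
    intro p hp a
    rw [re_pd sζ _ p hp]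
    simpa using congrArg Complex.re (hz p hp a)
  have hβ : ∀ p ∈ dom Ω, ∀ a : Fin n, pd (ez a.succ) (fun p => (zetaOf Q p).im) p
      = 1 / 2 * pd (ez 0) (fun p => (Q p).1 a.succ) p := by
    intro p hp a
    rw [im_pd sζ _ p hp]
    have := congrArg Complex.im (hz p hp a)
    simp at this
    linarith
  have hlap : ∀ p ∈ dom Ω, ∑ b : Fin n, pd (ez b.succ) (pd (ez b.succ) (zetaOf Q)) p
      = ((n / 4 * pd (ez 0) (pd (ez 0) fun p => (Q p).1 0) p : ℝ) : ℂ) * Complex.I := by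
    intro p hp
    have hb : ∀ b : Fin n, pd (ez b.succ) (pd (ez b.succ) (zetaOf Q)) p
        = ((1 / 4 * pd (ez 0) (pd (ez 0) fun p => (Q p).1 0) p : ℝ) : ℂ) * Complex.I := by
      intro b
      have s1 := pd_smooth hM sζ (ez b.succ)
      apply Complex.ext
      · rw [← re_pd s1 _ p hp, ← pd_congr hM (fun q hq => re_pd sζ _ q hq) _ hp,
          pd_eq_zero_of_const hM (fun q hq => hα q hq b) _ hp]
        simp
      · rw [← im_pd s1 _ p hp, ← pd_congr hM (fun q hq => im_pd sζ _ q hq) _ hp,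
          pd_congr hM (fun q hq => hβ q hq b) _ hp,
          pd_const_mul (differentiableAt_of_smooth hM (pd_smooth hM (sξ b.succ) _) hp),
          xi_time_space hM (im_s sζ) (fun a => sξ a.succ) h.killing hβ hp, if_pos rfl]
        simp
        ring
    rw [Finset.sum_congr rfl fun b _ => hb b]
    simp
    ring
  have hW : ∀ p ∈ dom Ω, Complex.I * pd (ez 0) (zetaOf Q) p
      + ((n / 4 * pd (ez 0) (pd (ez 0) fun p => (Q p).1 0) p : ℝ) : ℂ) * Complex.I
      + (pd (ez 0) (fun p => (Q p).1 0) p * potential S p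
        + (Q p).1 0 * pd (ez 0) (potential S) p
        + ∑ a : Fin n, (Q p).1 a.succ * pd (ez a.succ) (potential S) p
        + (zetaOf Q p).re * radial (potential S) p) = 0 := by
    intro p hp
    have := (h.classVal_and_radial hΩ hS.smooth hQ hp).1
    rw [classVal, hlap p hp, Fin.sum_univ_succ] at this
    linear_combination this
  refine ⟨sξ 0, re_s sζ, im_s sζ, fun a => sξ a.succ, re_s ss, re_s sr, im_s ss, im_s sr,
    fun p hp c => h.xi_vert p hp 0 c, fun p hp c => ?_, fun p hp c => ?_,
    fun a p hp c => h.xi_vert p hp a.succ c, h.tau_space, h.killing, hα, hβ,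
    fun p hp => ?_, fun p hp => ?_⟩
  · rw [re_pd sζ _ p hp, h.zeta_vert p hp]
    rfl
  · rw [im_pd sζ _ p hp, h.zeta_vert p hp]
    rfl
  · have := congrArg Complex.im (hW p hp)
    simp [-one_div] at this
    simp only [classForm, im_pd ss _ p hp, re_pd sζ _ p hp]
    linarith
  · have := congrArg Complex.re (hW p hp)
    simp [-one_div] at this
    simp only [classForm, re_pd ss _ p hp, im_pd sζ _ p hp]
    linarith

/-- The pairs `(a, b)` of indices with `b < a`. -/
abbrev LowerPairs (n : ℕ) : Type := (a : Fin n) × Fin a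

/-- The smaller index of a pair. -/
def LowerPairs.snd' (k : LowerPairs n) : Fin n := k.2.castLE k.1.2.le

/-- Values that determine a vector field of the algebra. -/
abbrev JetData (n : ℕ) : Type := Base n × (Fin n → ℝ) × ℝ × (LowerPairs n → ℝ)

lemma card_lowerPairs (n : ℕ) : Fintype.card (LowerPairs n) = n * (n - 1) / 2 := by
  rw [Fintype.card_sigma]
  simp only [Fintype.card_fin]
  rw [Fin.sum_univ_eq_sum_range (fun i => i) n, Finset.sum_range_id]

lemma finrank_jetData (n : ℕ) : Module.finrank ℝ (JetData n) = n * (n + 3) / 2 + 4 := by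
  simp only [Module.finrank_prod, Module.finrank_fintype_fun_eq_card, Fintype.card_fin,
    Complex.finrank_real_complex, Module.finrank_self, card_lowerPairs]
  -- Both halves are natural-number divisions; as the numerators differ by 4n, the quotients differ
  -- by exactly 2n. The truncated n - 1 forces the case split at n = 0.
  have h1 : n * (n + 3) = n * (n - 1) + 4 * n := by
    rcases n with _ | n
    · rfl
    · simp only [Nat.add_sub_cancel]
      ring
  rw [h1]
  omega

/-- The values at `p₀` that determine a vector field of the algebra. -/
def jetMap (hΩ : IsDomainRho Ω) (S : (Fin (n + 1) → ℝ) × ℝ → ℂ) {p₀ : Base n}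
    (hp₀ : p₀ ∈ dom Ω) : lieInvAlg hΩ S →ₗ[ℝ] JetData n where
  toFun Q := (Q.1 p₀, fun a => pd (ez 0) (fun p => (Q.1 p).1 a.succ) p₀,
    pd (ez 0) (pd (ez 0) fun p => (Q.1 p).1 0) p₀,
    fun k => pd (ez k.snd'.succ) (fun p => (Q.1 p).1 k.1.succ) p₀)
  map_add' Q R := by
    have hM := isOpen_dom hΩ.isOpen
    have sξ : ∀ Q : lieInvAlg hΩ S, ∀ κ, ContDiffOn ℝ ∞ (fun p => (Q.1 p).1 κ) (dom Ω) :=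
      fun Q κ => contDiffOn_pi.1 (contDiff_fst.comp_contDiffOn Q.2.1) κ
    have h1 : ∀ v κ, ∀ q ∈ dom Ω, pd v (fun p => ((Q + R : lieInvAlg hΩ S).1 p).1 κ) q
        = pd v (fun p => (Q.1 p).1 κ) q + pd v (fun p => (R.1 p).1 κ) q := fun v κ q hq =>
      pd_add (differentiableAt_of_smooth hM (sξ Q κ) hq)
        (differentiableAt_of_smooth hM (sξ R κ) hq) v
    have h2 : ∀ v κ, pd v (pd v fun p => ((Q + R : lieInvAlg hΩ S).1 p).1 κ) p₀
        = pd v (pd v fun p => (Q.1 p).1 κ) p₀ + pd v (pd v fun p => (R.1 p).1 κ) p₀ := fun v κ => by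
      rw [pd_congr hM (h1 v κ) _ hp₀, pd_add
        (differentiableAt_of_smooth hM (pd_smooth hM (sξ Q κ) _) hp₀)
        (differentiableAt_of_smooth hM (pd_smooth hM (sξ R κ) _) hp₀)]
    simp only [h1 _ _ p₀ hp₀, h2]
    rfl
  map_smul' c Q := by
    have hM := isOpen_dom hΩ.isOpen
    have sξ : ∀ κ, ContDiffOn ℝ ∞ (fun p => (Q.1 p).1 κ) (dom Ω) :=
      fun κ => contDiffOn_pi.1 (contDiff_fst.comp_contDiffOn Q.2.1) κ
    have h1 : ∀ v κ, ∀ q ∈ dom Ω, pd v (fun p => ((c • Q : lieInvAlg hΩ S).1 p).1 κ) q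
        = c * pd v (fun p => (Q.1 p).1 κ) q := fun v κ q hq =>
      pd_const_mul (differentiableAt_of_smooth hM (sξ κ) hq) c v
    have h2 : ∀ v κ, pd v (pd v fun p => ((c • Q : lieInvAlg hΩ S).1 p).1 κ) p₀
        = c * pd v (pd v fun p => (Q.1 p).1 κ) p₀ := fun v κ => by
      rw [pd_congr hM (h1 v κ) _ hp₀, pd_const_mul
        (differentiableAt_of_smooth hM (pd_smooth hM (sξ κ) _) hp₀)]
    simp only [h1 _ _ p₀ hp₀, h2]
    rfl

/-- If the data vanish, so does all of `jetFamily` at p₀: ζ because η = ζψ with ψ ≠ 0, τ_t because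
S_ρ ≠ 0 there, and the remaining ∂_bξ^a by the Killing relation. The linear system propagates this
to all of `dom Ω`. -/
lemma jetMap_injective (hn : 1 ≤ n) (hΩ : IsDomainRho Ω) (hS : IsClassS Ω S) {p₀ : Base n}
    (hp₀ : p₀ ∈ dom Ω) (hr : radial (potential S) p₀ ≠ 0) :
    Function.Injective (jetMap hΩ S hp₀) := by
  rw [← LinearMap.ker_eq_bot, LinearMap.ker_eq_bot']
  rintro ⟨Q, hQ, hQ0, hQi⟩ h0
  have hM := isOpen_dom hΩ.isOpen
  have ss := potential_smooth hΩ hS.smooth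
  have hdet := ((invCriterion_iff hM hQ ss).1 hQi).detEqns hn hM hQ
  have hsys := hdet.reducedSystem hΩ hS hQ
  have hη := fun p hp => hdet.eta_eq hΩ hS.smooth hQ hS.derivRho_ne (p := p) hp
  have e1 : Q p₀ = 0 := congrArg Prod.fst h0
  have e2 : ∀ a : Fin n, pd (ez 0) (fun p => (Q p).1 a.succ) p₀ = 0 := fun a =>
    congrFun (congrArg (fun d => d.2.1) h0) a
  have e3 : pd (ez 0) (pd (ez 0) fun p => (Q p).1 0) p₀ = 0 := congrArg (fun d => d.2.2.1) h0
  have e4 : ∀ k : LowerPairs n, pd (ez k.snd'.succ) (fun p => (Q p).1 k.1.succ) p₀ = 0 := fun k =>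
    congrFun (congrArg (fun d => d.2.2.2) h0) k
  have e5 : zetaOf Q p₀ = 0 := by
    have := hη p₀ hp₀
    rw [e1] at this
    exact (mul_eq_zero.1 this.symm).resolve_right (snd_ne_zero_of_mem_dom hΩ hp₀)
  have e6 : pd (ez 0) (fun p => (Q p).1 0) p₀ = 0 := by
    refine hsys.tau_time_eq_zero hM p₀.2 hp₀ (by simp [e1]) (by simp [e1]) (by simp [e5]) ?_
    rw [pd_re (differentiableAt_of_smooth hM ss hp₀), pd_im (differentiableAt_of_smooth hM ss hp₀)]
    by_contra hcon
    push Not at hcon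
    exact hr (Complex.ext hcon.1 hcon.2)
  have e7 : ∀ a b : Fin n, b < a → pd (ez b.succ) (fun p => (Q p).1 a.succ) p₀ = 0 := fun a b hab =>
    e4 ⟨a, ⟨b, hab⟩⟩
  have e8 : ∀ a b : Fin n, pd (ez b.succ) (fun p => (Q p).1 a.succ) p₀ = 0 := by
    intro a b
    have hk := hdet.killing p₀ hp₀ a b
    rw [e6, ite_self] at hk
    rcases lt_trichotomy a b with hab | hab | hab
    · rw [e7 b a hab] at hk
      linarith
    · subst hab
      linarith
    · exact e7 a b hab
  have hzero := hsys.eq_zero hn hM (isPreconnected_dom hΩ) hp₀ (by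
    intro i
    rcases i with i | a | a | ab
    · fin_cases i
      · simp [jetFamily, e1]
      · exact e6
      · exact e3
      · simp [jetFamily, e5]
      · simp [jetFamily, e5]
    · simp [jetFamily, e1]
    · exact e2 a
    · exact e8 ab.1 ab.2)
  have hQz : Q = 0 := by
    funext p
    by_cases hp : p ∈ dom Ω
    · refine Prod.ext (funext fun κ => ?_) ?_
      · exact Fin.cases (hzero p hp (.inl 0)) (fun a => hzero p hp (.inr (.inl a))) κ
      · have hz : zetaOf Q p = 0 := Complex.ext (hzero p hp (.inl 3)) (hzero p hp (.inl 4))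
        rw [hη p hp, hz, zero_mul]
        rfl
    · exact hQ0 p hp
  exact Subtype.ext hQz

lemma finite_and_finrank_le (hn : 1 ≤ n) (hΩ : IsDomainRho Ω) (hS : IsClassS Ω S) :
    Module.Finite ℝ (lieInvAlg hΩ S) ∧
      Module.finrank ℝ (lieInvAlg hΩ S) ≤ n * (n + 3) / 2 + 4 := by
  -- A single point with S_ρ ≠ 0 serves as base point; it is lifted to `dom Ω` by the positive real
  -- value ψ = ρ.
  obtain ⟨q, hq, hq'⟩ := hS.derivRho_ne Ω hΩ.isOpen subset_rfl hΩ.isConnected.nonempty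
  have hnorm : ‖((q.2 : ℝ) : ℂ)‖ = q.2 := by simp [abs_of_pos (hΩ.rho_pos q hq)]
  have hp₀ : ((q.1, (q.2 : ℂ)) : Base n) ∈ dom Ω := by
    simp only [dom, Set.mem_ofPred_eq, hnorm]
    exact hq
  have hr : radial (potential S) ((q.1, (q.2 : ℂ)) : Base n) ≠ 0 := by
    rw [radial_potential hΩ hS.smooth hp₀]
    simp only [hnorm]
    exact mul_ne_zero (by exact_mod_cast (hΩ.rho_pos q hq).ne') hq'
  have hinj := jetMap_injective hn hΩ hS hp₀ hr
  refine ⟨Module.Finite.of_injective _ hinj, ?_⟩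
  rw [← finrank_jetData]
  exact LinearMap.finrank_le_finrank_of_injective hinj

end UpperBound

/-! ### The nonlinearity ρ^{4/n} attains the bound. -/

section LowerBound

variable {n : ℕ} {Ω : Set ((Fin (n + 1) → ℝ) × ℝ)}

/-- The coefficients τ, ξ and ζ of `critField` are at most quadratic along every line, so their
derivatives can be read off as linear coefficients in t. -/
lemma pd_of_quadratic {E F : Type*} [NormedAddCommGroup E] [NormedSpace ℝ E]
    [NormedAddCommGroup F] [NormedSpace ℝ F] {f : E → F} {p v : E} {L R : F}
    (hf : DifferentiableAt ℝ f p) (h : ∀ t : ℝ, f (p + t • v) = f p + t • L + (t ^ 2) • R) :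
    pd v f p = L := by
  have h1 : HasDerivAt (fun t : ℝ => p + t • v) v 0 := by
    simpa using ((hasDerivAt_id (0 : ℝ)).smul_const v).const_add p
  have hf' : HasFDerivAt f (fderiv ℝ f p) (p + (0 : ℝ) • v) := by simpa using hf.hasFDerivAt
  have h2 := hf'.comp_hasDerivAt (0 : ℝ) h1
  have h3 : HasDerivAt (fun t : ℝ => f p + t • L + (t ^ 2) • R) L 0 := by
    simpa using (((hasDerivAt_id (0 : ℝ)).smul_const L).const_add (f p)).fun_add
      (((hasDerivAt_id (0 : ℝ)).pow 2).smul_const R)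
  have h4 : (f ∘ fun t : ℝ => p + t • v) = fun t : ℝ => f p + t • L + (t ^ 2) • R := funext h
  rw [h4] at h2
  exact h2.unique h3

lemma powerS_smooth (hΩ : IsDomainRho Ω) : ContDiffOn ℝ ∞ (powerS n) Ω := by
  intro q hq
  have h : ContDiffAt ℝ ∞ (fun q : (Fin (n + 1) → ℝ) × ℝ => q.2 ^ (4 / (n : ℝ))) q :=
    contDiffAt_snd.rpow_const_of_ne (hΩ.rho_pos q hq).ne'
  exact (Complex.ofRealCLM.contDiff.contDiffAt.comp q h).contDiffWithinAt

lemma derivRho_powerS (q : (Fin (n + 1) → ℝ) × ℝ) (hq : 0 < q.2) :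
    derivRho (powerS n) q = ((4 / n * q.2 ^ (4 / (n : ℝ) - 1) : ℝ) : ℂ) := by
  have h := (Real.hasDerivAt_rpow_const (p := 4 / (n : ℝ)) (Or.inl hq.ne')).ofReal_comp
  exact h.deriv

lemma isClassS_powerS (hn : 1 ≤ n) (hΩ : IsDomainRho Ω) : IsClassS Ω (powerS n) := by
  refine ⟨powerS_smooth hΩ, fun U _ hU ⟨q, hq⟩ => ⟨q, hq, ?_⟩⟩
  have hpos := hΩ.rho_pos q (hU hq)
  have hn' : (0 : ℝ) < n := by exact_mod_cast hn
  rw [derivRho_powerS q hpos, Complex.ofReal_ne_zero]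
  positivity

/-- S is homogeneous of degree 4/n in ρ; this lets Re ζ compensate τ_t in the classifying equation.
-/
lemma radial_powerS (hΩ : IsDomainRho Ω) {p : Base n} (hp : p ∈ dom Ω) :
    radial (potential (powerS n)) p = 4 / n * potential (powerS n) p := by
  have hpos : 0 < ‖p.2‖ := hΩ.rho_pos _ hp
  rw [radial_potential hΩ (powerS_smooth hΩ) hp, derivRho_powerS _ hpos, potential, powerS]
  have : ‖p.2‖ * ‖p.2‖ ^ (4 / (n : ℝ) - 1) = ‖p.2‖ ^ (4 / (n : ℝ)) := by
    rw [Real.rpow_sub_one hpos.ne']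
    field_simp
  rw [← this]
  push_cast
  ring

lemma pd_ez_powerS (hΩ : IsDomainRho Ω) {p : Base n} (hp : p ∈ dom Ω) (μ : Fin (n + 1)) :
    pd (ez μ) (potential (powerS n)) p = 0 :=
  pd_of_quadratic (R := 0) (differentiableAt_of_smooth (isOpen_dom hΩ.isOpen)
    (potential_smooth hΩ (powerS_smooth hΩ)) hp) fun t => by simp [potential, powerS]

/-- The skew-symmetric matrix with given entries below the diagonal. -/
def skew (k : LowerPairs n → ℝ) (a b : Fin n) : ℝ :=
  if h : b < a then k ⟨a, ⟨b, h⟩⟩ else if h : a < b then -k ⟨b, ⟨a, h⟩⟩ else 0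

lemma skew_add_skew (k : LowerPairs n → ℝ) (a b : Fin n) : skew k a b + skew k b a = 0 := by
  rcases lt_trichotomy a b with h | h | h
  · simp [skew, h, h.not_gt]
  · simp [skew, h]
  · simp [skew, h, h.not_gt]

lemma skew_lower (k : LowerPairs n → ℝ) (i : LowerPairs n) : skew k i.1 i.snd' = k i := by
  have h : i.snd' < i.1 := i.2.2
  rw [skew, dif_pos h]
  rfl

/-- The coefficient `τ` of the generic symmetry of the critical power nonlinearity, centred at
`z₀`. -/
def critTau (z₀ : Fin (n + 1) → ℝ) (d : JetData n) (p : Base n) : ℝ :=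
  -- `JetData` serves here only as a parameter space of the right dimension, not as the values taken
  -- by `jetMap`: the real part of `d.1.2` parametrises the scaling and its imaginary part the phase
  -- shift, while `d.2.2.1` is τ_tt/2.
  d.1.1 0 + d.1.2.re * (p.1 0 - z₀ 0) + d.2.2.1 * (p.1 0 - z₀ 0) ^ 2

/-- The coefficients `ξ^a` of the generic symmetry of the critical power nonlinearity. -/
def critXi (z₀ : Fin (n + 1) → ℝ) (d : JetData n) (a : Fin n) (p : Base n) : ℝ :=
  (d.1.2.re / 2 + d.2.2.1 * (p.1 0 - z₀ 0)) * (p.1 a.succ - z₀ a.succ)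
    + ∑ b, skew d.2.2.2 a b * (p.1 b.succ - z₀ b.succ) + d.1.1 a.succ + d.2.1 a * (p.1 0 - z₀ 0)

/-- The coefficient `ζ` of the generic symmetry of the critical power nonlinearity. -/
def critZeta (z₀ : Fin (n + 1) → ℝ) (d : JetData n) (p : Base n) : ℂ :=
  ((d.2.2.1 / 4 * ∑ b : Fin n, (p.1 b.succ - z₀ b.succ) ^ 2
      + 1 / 2 * ∑ b, d.2.1 b * (p.1 b.succ - z₀ b.succ) + d.1.2.im : ℝ) : ℂ) * Complex.I
    - ((n / 4 * (d.1.2.re + 2 * d.2.2.1 * (p.1 0 - z₀ 0)) : ℝ) : ℂ)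

/-- The generic symmetry of the critical power nonlinearity. -/
def critField (z₀ : Fin (n + 1) → ℝ) (d : JetData n) (p : Base n) : Base n :=
  (Fin.cons (critTau z₀ d p) fun a => critXi z₀ d a p, critZeta z₀ d p * p.2)

variable (z₀ : Fin (n + 1) → ℝ) (d : JetData n)

lemma critTau_smooth : ContDiff ℝ ∞ (critTau z₀ d) := by
  unfold critTau
  fun_prop

lemma critXi_smooth (a : Fin n) : ContDiff ℝ ∞ (critXi z₀ d a) := by
  unfold critXi
  fun_prop

lemma critZeta_smooth : ContDiff ℝ ∞ (critZeta z₀ d) := by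
  have h1 : ContDiff ℝ ∞ fun p : Base n => d.2.2.1 / 4 * ∑ b : Fin n, (p.1 b.succ - z₀ b.succ) ^ 2
      + 1 / 2 * ∑ b, d.2.1 b * (p.1 b.succ - z₀ b.succ) + d.1.2.im := by fun_prop
  have h2 : ContDiff ℝ ∞ fun p : Base n =>
      n / 4 * (d.1.2.re + 2 * d.2.2.1 * (p.1 0 - z₀ 0)) := by fun_prop
  exact ((Complex.ofRealCLM.contDiff.comp h1).mul contDiff_const).sub
    (Complex.ofRealCLM.contDiff.comp h2)

lemma critField_smooth : ContDiff ℝ ∞ (critField z₀ d) := by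
  refine ContDiff.prodMk (contDiff_pi.2 fun κ => ?_) ((critZeta_smooth z₀ d).mul contDiff_snd)
  refine Fin.cases ?_ (fun a => ?_) κ
  · exact critTau_smooth z₀ d
  · exact critXi_smooth z₀ d a

lemma pd_critTau (v p : Base n) :
    pd v (critTau z₀ d) p = (d.1.2.re + 2 * d.2.2.1 * (p.1 0 - z₀ 0)) * v.1 0 :=
  pd_of_quadratic (R := d.2.2.1 * v.1 0 ^ 2)
    ((critTau_smooth z₀ d).differentiable (by simp) p) fun t => by
      simp only [critTau, Prod.fst_add, Prod.smul_fst, Pi.add_apply, Pi.smul_apply, smul_eq_mul]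
      ring

lemma pd_critXi (a : Fin n) (v p : Base n) :
    pd v (critXi z₀ d a) p = d.2.2.1 * v.1 0 * (p.1 a.succ - z₀ a.succ)
      + (d.1.2.re / 2 + d.2.2.1 * (p.1 0 - z₀ 0)) * v.1 a.succ
      + ∑ b, skew d.2.2.2 a b * v.1 b.succ + d.2.1 a * v.1 0 :=
  pd_of_quadratic (R := d.2.2.1 * v.1 0 * v.1 a.succ)
    ((critXi_smooth z₀ d a).differentiable (by simp) p) fun t => by
      have h : ∑ b, skew d.2.2.2 a b * (p.1 b.succ + t * v.1 b.succ - z₀ b.succ)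
          = ∑ b, skew d.2.2.2 a b * (p.1 b.succ - z₀ b.succ)
            + t * ∑ b, skew d.2.2.2 a b * v.1 b.succ := by
        rw [Finset.mul_sum, ← Finset.sum_add_distrib]
        exact Finset.sum_congr rfl fun b _ => by ring
      simp only [critXi, Prod.fst_add, Prod.smul_fst, Pi.add_apply, Pi.smul_apply, smul_eq_mul, h]
      ring

lemma pd_critZeta (v p : Base n) :
    pd v (critZeta z₀ d) p = ((d.2.2.1 / 2 * ∑ b : Fin n, (p.1 b.succ - z₀ b.succ) * v.1 b.succ
      + 1 / 2 * ∑ b, d.2.1 b * v.1 b.succ : ℝ) : ℂ) * Complex.I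
      - ((n / 2 * d.2.2.1 * v.1 0 : ℝ) : ℂ) :=
  pd_of_quadratic (R := ((d.2.2.1 / 4 * ∑ b : Fin n, v.1 b.succ ^ 2 : ℝ) : ℂ) * Complex.I)
    ((critZeta_smooth z₀ d).differentiable (by simp) p) fun t => by
      have h1 : ∑ b : Fin n, (p.1 b.succ + t * v.1 b.succ - z₀ b.succ) ^ 2
          = ∑ b : Fin n, (p.1 b.succ - z₀ b.succ) ^ 2
            + 2 * t * ∑ b : Fin n, (p.1 b.succ - z₀ b.succ) * v.1 b.succ
            + t ^ 2 * ∑ b : Fin n, v.1 b.succ ^ 2 := by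
        rw [Finset.mul_sum, Finset.mul_sum, ← Finset.sum_add_distrib, ← Finset.sum_add_distrib]
        exact Finset.sum_congr rfl fun b _ => by ring
      have h2 : ∑ b, d.2.1 b * (p.1 b.succ + t * v.1 b.succ - z₀ b.succ)
          = ∑ b, d.2.1 b * (p.1 b.succ - z₀ b.succ) + t * ∑ b, d.2.1 b * v.1 b.succ := by
        rw [Finset.mul_sum, ← Finset.sum_add_distrib]
        exact Finset.sum_congr rfl fun b _ => by ring
      simp only [critZeta, Prod.fst_add, Prod.smul_fst, Pi.add_apply, Pi.smul_apply, smul_eq_mul,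
        h1, h2, Complex.real_smul]
      push_cast
      ring

lemma pd_space_critZeta (b : Fin n) (p : Base n) : pd (ez b.succ) (critZeta z₀ d) p
    = ((d.2.2.1 / 2 * (p.1 b.succ - z₀ b.succ) + 1 / 2 * d.2.1 b : ℝ) : ℂ) * Complex.I := by
  rw [pd_critZeta]
  simp [Pi.single_apply, (Fin.succ_ne_zero _).symm]

lemma pd_pd_space_critZeta (b : Fin n) (p : Base n) :
    pd (ez b.succ) (pd (ez b.succ) (critZeta z₀ d)) p = ((d.2.2.1 / 2 : ℝ) : ℂ) * Complex.I := by
  have hM := isOpen_univ (X := Base n)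
  have hs := pd_smooth hM (critZeta_smooth z₀ d).contDiffOn (ez b.succ)
  refine pd_of_quadratic (R := 0) (differentiableAt_of_smooth hM hs (Set.mem_univ p)) fun t => ?_
  rw [pd_space_critZeta, pd_space_critZeta]
  simp
  ring

lemma zetaOf_critField : zetaOf (critField z₀ d) = critZeta z₀ d := by
  funext p
  have h1 := pd_mul ((critZeta_smooth z₀ d).differentiable (by simp) p)
    (differentiableAt_snd (𝕜 := ℝ) (p := p)) (vert 1)
  rw [pd_vert_snd, pd_critZeta] at h1
  change pd (vert 1) (fun q : Base n => critZeta z₀ d q * q.2) p = _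
  simpa using h1

lemma pd_space_critXi (a b : Fin n) (p : Base n) : pd (ez b.succ) (critXi z₀ d a) p
    = (if a = b then d.1.2.re / 2 + d.2.2.1 * (p.1 0 - z₀ 0) else 0) + skew d.2.2.2 a b := by
  rw [pd_critXi]
  simp [Pi.single_apply, (Fin.succ_ne_zero _).symm]

/-- Re ζ = -(n/4)τ_t makes τ_t S and (Re ζ) ρS_ρ cancel. The imaginary part of ζ is chosen so that
2ζ_a = iξ^a_t, and then iζ_t = -(in/4)τ_tt cancels Δζ = (in/4)τ_tt. -/
lemma detEqns_critField (hn : 1 ≤ n) (hΩ : IsDomainRho Ω) :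
    DetEqns (dom Ω) (potential (powerS n)) (critField z₀ d) := by
  have hn' : (n : ℂ) ≠ 0 := by exact_mod_cast (by omega : n ≠ 0)
  have hM := isOpen_dom hΩ.isOpen
  have hf := (critField_smooth z₀ d).contDiffOn (s := dom Ω)
  have eτ : (fun p => (critField z₀ d p).1 0) = critTau z₀ d := rfl
  have eξ : ∀ a : Fin n, (fun p => (critField z₀ d p).1 a.succ) = critXi z₀ d a := fun a => rfl
  have eη : (fun p => (critField z₀ d p).2) = fun p => critZeta z₀ d p * p.2 := rfl
  have tau_space : ∀ p ∈ dom Ω, ∀ a : Fin n, pd (ez a.succ) (critTau z₀ d) p = 0 := by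
    intro p _ a
    rw [pd_critTau]
    simp [(Fin.succ_ne_zero _).symm]
  have killing : ∀ p ∈ dom Ω, ∀ a b : Fin n, pd (ez a.succ) (critXi z₀ d b) p
      + pd (ez b.succ) (critXi z₀ d a) p = if a = b then pd (ez 0) (critTau z₀ d) p else 0 := by
    intro p _ a b
    rw [pd_space_critXi, pd_space_critXi, pd_critTau]
    have hk := skew_add_skew d.2.2.2 a b
    by_cases hab : a = b
    · simp only [hab, if_true, Pi.single_eq_same] at hk ⊢
      linarith
    · simp only [hab, Ne.symm hab, if_false] at hk ⊢
      linarith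
  have zeta_vert : ∀ p ∈ dom Ω, ∀ c : ℂ, pd (vert c) (critZeta z₀ d) p = 0 := by
    intro p _ c
    rw [pd_critZeta]
    simp
  refine ⟨tau_space, ?_, killing, ?_, ?_, ?_, fun p hp => ?_⟩
  · intro p _ κ c
    refine Fin.cases ?_ (fun a => ?_) κ
    · rw [eτ, pd_critTau]
      simp
    · rw [eξ, pd_critXi]
      simp
  · intro p hp c
    rw [zetaOf_critField, eη, pd_mul ((critZeta_smooth z₀ d).differentiable (by simp) p)
      differentiableAt_snd, zeta_vert p hp, pd_vert_snd]
    ring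
  · rw [zetaOf_critField]
    exact zeta_vert
  · intro p hp a
    rw [zetaOf_critField, eξ, Finset.sum_eq_zero fun b _ => pd_pd_eq_zero_of_killing hM
      (critTau_smooth z₀ d).contDiffOn (fun a => (critXi_smooth z₀ d a).contDiffOn) tau_space
      killing hp a b b, pd_space_critZeta, pd_critXi]
    simp
    ring
  · refine rest_of_classVal hΩ (powerS_smooth hΩ) hf (fun q _ => ?_) hp ?_
    · rw [zetaOf_critField]
      rfl
    · have hre : (critZeta z₀ d p).re = -(n / 4 * (d.1.2.re + 2 * d.2.2.1 * (p.1 0 - z₀ 0))) := by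
        rw [critZeta, Complex.sub_re, Complex.re_ofReal_mul, Complex.I_re, Complex.ofReal_re]
        ring
      rw [classVal, zetaOf_critField, eτ, radial_powerS hΩ hp, pd_critTau, pd_critZeta, hre]
      simp only [pd_ez_powerS hΩ hp, pd_pd_space_critZeta]
      simp [Fin.succ_ne_zero]
      field_simp
      ring

/-- The criterion at p involves only the germ of the field at p, so on the open set M the extension
by zero may replace the globally defined field. -/
lemma CritOn.congr {M : Set (Base n)} (hM : IsOpen M) {s : Base n → ℂ} {Q R : Base n → Base n}
    (hQR : ∀ p ∈ M, Q p = R p) (h : CritOn M s R) : CritOn M s Q := by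
  intro p hp u U hU he
  have h1 : ∀ v, ∀ q ∈ M, pd v (fun p => (Q p).2) q = pd v (fun p => (R p).2) q := fun v q hq =>
    pd_congr hM (fun p hp => by rw [hQR p hp]) v hq
  have h2 : ∀ κ v, ∀ q ∈ M, pd v (fun p => (Q p).1 κ) q = pd v (fun p => (R p).1 κ) q :=
    fun κ v q hq => pd_congr hM (fun p hp => by rw [hQR p hp]) v hq
  have h3 := h p hp u U hU he
  rw [critVal] at h3 ⊢
  simpa only [h1 _ p hp, h2 _ _ p hp, pd_congr hM (h1 _) _ hp, pd_congr hM (h2 _ _) _ hp,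
    hQR p hp] using h3

lemma critField_add (d' : JetData n) (p : Base n) :
    critField z₀ (d + d') p = critField z₀ d p + critField z₀ d' p := by
  have hs : ∀ a b, skew (d + d').2.2.2 a b = skew d.2.2.2 a b + skew d'.2.2.2 a b := by
    intro a b
    simp only [skew]
    split_ifs <;> simp [add_comm]
  have e1 : critTau z₀ (d + d') p = critTau z₀ d p + critTau z₀ d' p := by
    simp [critTau]
    ring
  have e2 : ∀ a, critXi z₀ (d + d') a p = critXi z₀ d a p + critXi z₀ d' a p := fun a => by
    simp only [critXi, hs, add_mul, Finset.sum_add_distrib]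
    simp
    ring
  have e3 : critZeta z₀ (d + d') p = critZeta z₀ d p + critZeta z₀ d' p := by
    simp [critZeta, add_mul, Finset.sum_add_distrib]
    ring
  refine Prod.ext (funext fun κ => Fin.cases e1 e2 κ) ?_
  simp only [critField, e3, add_mul, Prod.snd_add]

lemma critField_smul (c : ℝ) (p : Base n) : critField z₀ (c • d) p = c • critField z₀ d p := by
  have hs : ∀ a b, skew (c • d).2.2.2 a b = c * skew d.2.2.2 a b := by
    intro a b
    simp only [skew]
    split_ifs <;> simp
  have e1 : critTau z₀ (c • d) p = c * critTau z₀ d p := by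
    simp [critTau]
    ring
  have e2 : ∀ a, critXi z₀ (c • d) a p = c * critXi z₀ d a p := fun a => by
    simp only [critXi, hs, mul_assoc, ← Finset.mul_sum]
    simp
    ring
  have e3 : critZeta z₀ (c • d) p = c * critZeta z₀ d p := by
    simp [critZeta, mul_assoc, ← Finset.mul_sum]
    ring
  refine Prod.ext (funext fun κ => Fin.cases e1 e2 κ) ?_
  simp only [critField, e3, mul_assoc, Prod.smul_snd, Complex.real_smul]

open Classical in
/-- The generic symmetries of the critical power nonlinearity, as elements of the algebra. -/
def critMap (hn : 1 ≤ n) (hΩ : IsDomainRho Ω) : JetData n →ₗ[ℝ] lieInvAlg hΩ (powerS n) where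
  toFun d := ⟨fun p => if p ∈ dom Ω then critField z₀ d p else 0, by
    have hM := isOpen_dom hΩ.isOpen
    have he : ∀ p ∈ dom Ω, (if p ∈ dom Ω then critField z₀ d p else 0) = critField z₀ d p :=
      fun p hp => if_pos hp
    have hf := (critField_smooth z₀ d).contDiffOn (s := dom Ω)
    have hs := hf.congr he
    refine ⟨hs, fun p hp => if_neg hp, ?_⟩
    rw [invCriterion_iff hM hs (potential_smooth hΩ (powerS_smooth hΩ))]
    exact ((detEqns_critField z₀ d hn hΩ).critOn hM hf).congr hM he⟩
  map_add' d d' := by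
    refine Subtype.ext (funext fun p => ?_)
    by_cases hp : p ∈ dom Ω
    · simp [hp, critField_add]
    · simp [hp]
  map_smul' c d := by
    refine Subtype.ext (funext fun p => ?_)
    by_cases hp : p ∈ dom Ω
    · simp [hp, critField_smul]
    · simp [hp]

/-- With the family centred at the base point, each parameter is, up to a nonzero factor, a value or
a derivative at p₀ of τ, ξ or Im ζ. -/
lemma critMap_injective (hn : 1 ≤ n) (hΩ : IsDomainRho Ω) {p₀ : Base n} (hp₀ : p₀ ∈ dom Ω) :
    Function.Injective (critMap p₀.1 hn hΩ) := by
  rw [← LinearMap.ker_eq_bot, LinearMap.ker_eq_bot']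
  intro d hd
  have hM := isOpen_dom hΩ.isOpen
  have hz : ∀ p ∈ dom Ω, critField p₀.1 d p = 0 := by
    intro p hp
    have := congrFun (congrArg Subtype.val hd) p
    simpa [critMap, hp] using this
  have zτ : ∀ p ∈ dom Ω, critTau p₀.1 d p = 0 := fun p hp =>
    congrFun (congrArg Prod.fst (hz p hp)) 0
  have zξ : ∀ a, ∀ p ∈ dom Ω, critXi p₀.1 d a p = 0 := fun a p hp =>
    congrFun (congrArg Prod.fst (hz p hp)) a.succ
  have zζ : critZeta p₀.1 d p₀ = 0 :=
    (mul_eq_zero.1 (congrArg Prod.snd (hz p₀ hp₀))).resolve_right (snd_ne_zero_of_mem_dom hΩ hp₀)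
  have zτt : ∀ p ∈ dom Ω, pd (ez 0) (critTau p₀.1 d) p = 0 := fun p hp =>
    pd_eq_zero_of_const hM zτ _ hp
  have c1 : d.1.1 0 = 0 := by simpa [critTau] using zτ p₀ hp₀
  have c2 : d.1.2.re = 0 := by
    have := zτt p₀ hp₀
    rw [pd_critTau] at this
    simpa using this
  have c3 : ∀ a, d.1.1 (Fin.succ a) = 0 := fun a => by simpa [critXi] using zξ a p₀ hp₀
  have c4 : d.1.2.im = 0 := by simpa [critZeta] using congrArg Complex.im zζ
  have c5 : ∀ a, d.2.1 a = 0 := fun a => by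
    have := pd_eq_zero_of_const hM (zξ a) (ez 0) hp₀
    rw [pd_critXi] at this
    simpa [Fin.succ_ne_zero] using this
  have c6 : d.2.2.1 = 0 := by
    have h1 := pd_eq_zero_of_const hM zτt (ez 0) hp₀
    have h2 : pd (ez 0) (pd (ez 0) (critTau p₀.1 d)) p₀ = 2 * d.2.2.1 := by
      refine pd_of_quadratic (R := 0) (differentiableAt_of_smooth hM
        (pd_smooth hM (critTau_smooth p₀.1 d).contDiffOn _) hp₀) fun t => ?_
      rw [pd_critTau, pd_critTau]
      simp
      ring
    linarith
  -- The scaling contribution to ∂_bξ^a at the centre is already zero by `c2`, so the entry of the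
  -- rotation matrix remains.
  have c7 : ∀ k, d.2.2.2 k = 0 := fun k => by
    have := pd_eq_zero_of_const hM (zξ k.1) (ez k.snd'.succ) hp₀
    rw [pd_space_critXi, skew_lower] at this
    simpa [c2] using this
  refine Prod.ext (Prod.ext (funext fun κ => Fin.cases c1 c3 κ) (Complex.ext c2 c4))
    (Prod.ext (funext c5) (Prod.ext c6 (funext c7)))

lemma le_finrank_powerS (hn : 1 ≤ n) (hΩ : IsDomainRho Ω) :
    n * (n + 3) / 2 + 4 ≤ Module.finrank ℝ (lieInvAlg hΩ (powerS n)) := by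
  obtain ⟨q, hq⟩ := hΩ.isConnected.nonempty
  have hp₀ : ((q.1, (q.2 : ℂ)) : Base n) ∈ dom Ω := by
    simpa [dom, abs_of_pos (hΩ.rho_pos q hq)] using hq
  -- `finrank` is 0 for infinite-dimensional spaces, so finiteness from the upper bound is needed
  -- before injectivity can bound it from below.
  have := (finite_and_finrank_le hn hΩ (isClassS_powerS hn hΩ)).1
  rw [← finrank_jetData]
  exact LinearMap.finrank_le_finrank_of_injective (critMap_injective hn hΩ hp₀)

end LowerBound

end NLS

end

theorem mainTheorem6 (n : ℕ) (hn : 1 ≤ n) (Ω : Set ((Fin (n + 1) → ℝ) × ℝ))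
    (hΩ : NLS.IsDomainRho Ω) :
    (∀ S : (Fin (n + 1) → ℝ) × ℝ → ℂ, NLS.IsClassS Ω S →
      Module.Finite ℝ (NLS.lieInvAlg hΩ S) ∧
        Module.finrank ℝ (NLS.lieInvAlg hΩ S) ≤ n * (n + 3) / 2 + 4) ∧
    NLS.IsClassS Ω (NLS.powerS n) ∧
    Module.finrank ℝ (NLS.lieInvAlg hΩ (NLS.powerS n)) = n * (n + 3) / 2 + 4 :=
  ⟨fun _ hS => NLS.finite_and_finrank_le hn hΩ hS, NLS.isClassS_powerS hn hΩ,
    le_antisymm (NLS.finite_and_finrank_le hn hΩ (NLS.isClassS_powerS hn hΩ)).2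
      (NLS.le_finrank_powerS hn hΩ)⟩
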